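/- Consider the discrete-time system $y_{t+1}=\theta f(y_t)+u_t+w_{t+1}$, $t\ge 0$, where $f:\mathbb R\to\mathbb R$ is a known piecewise continuous function (finitely many discontinuities in every bounded interval, with finite one-sided limits at each of them), the noise $w_1,w_2,\dots$ is i.i.d. with law $N(0,1)$, the unknown parameter $\theta\sim N(\theta_0,P_0)$, $P_0>0$, is independent of $\{w_t\}$, and the initial value $y_0$ is independent of $(\theta,\{w_t\})$ (for instance, any deterministic $y_0\in\mathbb R$). A feedback control law is a choice of inputs $u_t=g_t(y_0,\dots,y_t)$ with measurable functions $g_t$. It globally stabilizes the system if, for every such initial value, $\sup_{t\ge1}\frac1t\sum_{i=1}^t y_i^2<+\infty$ almost surely; the system is globally stabilizable if some feedback control law globally stabilizes it. For $b\in\mathbb R$ and $L>0$ put $S_b^L=\{x\in\mathbb R:|f(x)|<L|x|^b\}$, and let $\ell$ denote Lebesgue measure. **Theorem.** Suppose that (i) for some real $a\ge4$, $|f(x)|=O(|x|^a)+O(1)$ as $|x|\to+\infty$; (ii) for some real $b<(1+x_{\min})^2$ and some $L>0$, $$\liminf_{l\to+\infty}\frac{\ell(S_b^L\cap[-l,l])}{l}\cdot\log(\log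 l)>0,$$ where $x_{\min}$ is the smallest solution of $x^2-(a-2)x+1=0$. Then the system is globally stabilizable. More precisely, it is globally stabilized by the least-squares control law $u_t=-\theta_t f(y_t)$, where, with $\phi_t=f(y_t)$ and $a_t=(1+\phi_t^2P_t)^{-1}$, the estimates are given by $$\theta_{t+1}=\theta_t+a_tP_t\phi_t\,(y_{t+1}-u_t-\phi_t\theta_t),\qquad P_{t+1}=P_t-a_tP_t^2\phi_t^2,\qquad t\ge0,$$ started from the prior mean $\theta_0$ and the prior variance $P_0$. -/

import Mathlib

open MeasureTheory ProbabilityTheory Filter Asymptotics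
open scoped Topology NNReal ENNReal

/-- `f : ℝ → ℝ` is piecewise continuous: its discontinuities lie in a set `D` with finitely many
points in every bounded interval, and at each point of `D` the two one-sided limits exist
(as real numbers). -/
def IsPiecewiseContinuous (f : ℝ → ℝ) : Prop :=
  ∃ D : Set ℝ, (∀ R : ℝ, (D ∩ Set.Icc (-R) R).Finite) ∧
    (∀ x, x ∉ D → ContinuousAt f x) ∧
    ∀ x ∈ D, (∃ c : ℝ, Tendsto f (𝓝[<] x) (𝓝 c)) ∧ (∃ c : ℝ, Tendsto f (𝓝[>] x) (𝓝 c))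

/-- The noise `w 1, w 2, …` is i.i.d. with standard normal law. (The value `w 0` never enters the
system and is not constrained.) -/
structure IsStandardGaussianNoise {Ω : Type*} [MeasurableSpace Ω] (μ : Measure Ω)
    (w : ℕ → Ω → ℝ) : Prop where
  measurable : ∀ t, Measurable (w (t + 1))
  indep : iIndepFun (fun t => w (t + 1)) μ
  law : ∀ t, μ.map (w (t + 1)) = gaussianReal 0 1

/-- The parameter `θ` has law `N(θ₀, P₀)` and is independent of the noise `w 1, w 2, …`. -/
structure IsGaussianParameter {Ω : Type*} [MeasurableSpace Ω] (μ : Measure Ω)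
    (w : ℕ → Ω → ℝ) (θ : Ω → ℝ) (θ₀ : ℝ) (P₀ : ℝ≥0) : Prop where
  measurable : Measurable θ
  law : μ.map θ = gaussianReal θ₀ P₀
  indep : IndepFun θ (fun ω (t : ℕ) => w (t + 1) ω) μ

/-- A feedback control law: `g t` is a functional of the output path `(y 0, y 1, …)` which is
measurable with respect to the σ-algebra generated by `y 0, …, y t`. The input at time `t` is
`u t = g t y`. -/
def IsFeedbackLaw (g : ℕ → (ℕ → ℝ) → ℝ) : Prop :=
  ∀ t, Measurable[Filtration.piLE (X := fun _ : ℕ => ℝ) t] (g t)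

/-- `y` is an output process of the system `y (t+1) = θ f(y t) + u t + w (t+1)`, `t ≥ 0`, under the
control law `u t = g t y`, with an initial value `y 0` independent of `θ` and the noise
(for instance, any deterministic initial value). -/
structure IsClosedLoopOutput {Ω : Type*} [MeasurableSpace Ω] (μ : Measure Ω) (f : ℝ → ℝ)
    (θ : Ω → ℝ) (w : ℕ → Ω → ℝ) (g : ℕ → (ℕ → ℝ) → ℝ) (y : ℕ → Ω → ℝ) : Prop where
  measurable_init : Measurable (y 0)
  indep_init : IndepFun (y 0) (fun ω => (θ ω, fun t : ℕ => w (t + 1) ω)) μ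
  step : ∀ t ω, y (t + 1) ω = θ ω * f (y t ω) + g t (fun i => y i ω) + w (t + 1) ω

/-- The control law `g` globally stabilizes the system: it is a feedback control law and, for every
initial value, `sup_{t ≥ 1} (1/t) ∑_{i=1}^t (y i)² < ∞` almost surely. -/
def GloballyStabilizedBy {Ω : Type*} [MeasurableSpace Ω] (μ : Measure Ω) (f : ℝ → ℝ)
    (θ : Ω → ℝ) (w : ℕ → Ω → ℝ) (g : ℕ → (ℕ → ℝ) → ℝ) : Prop :=
  IsFeedbackLaw g ∧ ∀ y : ℕ → Ω → ℝ, IsClosedLoopOutput μ f θ w g y →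
    ∀ᵐ ω ∂μ, BddAbove
      ((fun t : ℕ => (1 / (t : ℝ)) * ∑ i ∈ Finset.Icc 1 t, (y i ω) ^ 2) '' Set.Ici 1)

/-- The system is globally stabilizable: some feedback control law globally stabilizes it. -/
def GloballyStabilizable {Ω : Type*} [MeasurableSpace Ω] (μ : Measure Ω) (f : ℝ → ℝ)
    (θ : Ω → ℝ) (w : ℕ → Ω → ℝ) : Prop :=
  ∃ g : ℕ → (ℕ → ℝ) → ℝ, GloballyStabilizedBy μ f θ w g

/-- One step of the recursive least-squares algorithm. From the current pair `s = (θ_t, P_t)`, the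
regressor `φ = φ_t`, the input `u = u_t` and the new output `y' = y_{t+1}`, it computes
`θ_{t+1} = θ_t + a_t P_t φ_t (y_{t+1} - u_t - φ_t θ_t)` and `P_{t+1} = P_t - a_t P_t φ_t φ_t P_t`,
where `a_t = (1 + φ_t P_t φ_t)⁻¹`. -/
noncomputable def lsStep (s : ℝ × ℝ) (φ u y' : ℝ) : ℝ × ℝ :=
  (s.1 + (1 + φ * s.2 * φ)⁻¹ * s.2 * φ * (y' - u - φ * s.1),
    s.2 - (1 + φ * s.2 * φ)⁻¹ * s.2 * φ * φ * s.2)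

/-- The least-squares pair `(θ_t, P_t)` along the output path `y`, started from `(θ₀, P₀)`, with
regressor `φ_t = f (y t)` and input `u_t = -θ_t f (y t)`. -/
noncomputable def lsState (f : ℝ → ℝ) (θ₀ P₀ : ℝ) (y : ℕ → ℝ) : ℕ → ℝ × ℝ
  | 0 => (θ₀, P₀)
  | t + 1 => lsStep (lsState f θ₀ P₀ y t) (f (y t))
      (-(lsState f θ₀ P₀ y t).1 * f (y t)) (y (t + 1))

/-- The certainty-equivalence control law based on least squares: `u_t = -θ_t f (y t)`. -/
noncomputable def lsController (f : ℝ → ℝ) (θ₀ P₀ : ℝ) (t : ℕ) (y : ℕ → ℝ) : ℝ :=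
  -(lsState f θ₀ P₀ y t).1 * f (y t)

/-- The set `S_b^L` of all `x` with `|f x| < L |x| ^ b`. -/
def slowGrowthSet (f : ℝ → ℝ) (b L : ℝ) : Set ℝ :=
  {x | |f x| < L * |x| ^ b}

/-! Let r_t = 1 / P_t, so r_{t+1} = r_t + f(y_t)². The least-squares recursion is Bayesian updating:
given y_0, …, y_t the law of θ is N(θ_t, P_t). Since y_{t+1} = f(y_t)(θ - θ_t) + w_{t+1}, the output
is y_{t+1} = σ_t v_t with v_t standard normal and independent of the past and σ_t² = 1 + P_t f(y_t)²
= r_{t+1} / r_t. Averages of v_t² are bounded by the strong law, so it suffices to bound r_{t+1} /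
r_t along almost every path.

Take x_t = log r_t. The growth bound on f gives x_{t+2} ≤ max(x_{t+1}, a (x_{t+1} - x_t)) up to a
noise term. That term is o(x_{t+1}), because v_t = O(log t) while r_t grows at least linearly. Hence
ρ_t = x_{t+1} / x_t satisfies ρ_{t+1} ≤ max(1, a (1 - 1/ρ_t)) + o(1). The nontrivial fixed points p
≤ q are 1 plus the roots of x² - (a-2)x + 1, and p + q = pq = a. So limsup ρ is either 1 or in [p,
q], and ρ tends to 1 once it drops below p. A visit to the slow growth set replaces a by b in one
step; from near q this lands near or below max(1, b/p), which is below p because b < p². When ρ → 1,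
the noise and growth terms together stay below x_{t+1}, and r_{t+1} / r_t is eventually at most 2.

Visits do occur. If ρ stays above some κ > 1, then σ_t → ∞; but ρ is bounded, so log log σ_t = O(t).
The density hypothesis then gives a visit at time t + 1 conditional probability at least c / (t +
1), whose sum diverges. The pathwise half is `variance_ratio_bounded`; the probabilistic inputs are
`map_history_innovation`, `ae_exists_linear_le_information` and `ae_frequently_mem`. -/

/-! ### Limiting behaviour of the exponent recursion -/

lemma one_sub_inv_mul_mono {c s t : ℝ} (hc : 0 ≤ c) (hs : 0 < s) (hst : s ≤ t) :
    c * (1 - s⁻¹) ≤ c * (1 - t⁻¹) := by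
  gcongr

lemma eventually_of_eventually_succ {P : ℕ → Prop} (h : ∀ᶠ t in atTop, P (t + 1)) :
    ∀ᶠ t in atTop, P t := by
  rw [← map_add_atTop_eq_nat 1]
  exact h

/-- The limsup of a sequence with `ρ (t+1) ≤ max 1 (a (1 - 1 / ρ t)) + o(1)` is subject to the
limiting inequality. -/
lemma exists_asymptotic_bound {ρ ε : ℕ → ℝ} {a M : ℝ} (ha : 0 ≤ a)
    (h1 : ∀ᶠ t in atTop, 1 ≤ ρ t) (hM : ∀ᶠ t in atTop, ρ t ≤ M)
    (hε : Tendsto ε atTop (𝓝 0))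
    (hrec : ∀ᶠ t in atTop, ρ (t + 1) ≤ max 1 (a * (1 - (ρ t)⁻¹)) + ε t) :
    ∃ R, 1 ≤ R ∧ R ≤ max 1 (a * (1 - R⁻¹)) ∧ (∀ δ > 0, ∀ᶠ t in atTop, ρ t ≤ R + δ) ∧
      ∀ κ, (∀ᶠ t in atTop, ρ t ≤ κ) → R ≤ κ := by
  have hbdd : IsBoundedUnder (· ≤ ·) atTop ρ := ⟨M, hM⟩
  have hcob : IsCoboundedUnder (· ≤ ·) atTop ρ :=
    IsBoundedUnder.isCoboundedUnder_le ⟨1, h1⟩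
  have hle : ∀ κ, (∀ᶠ t in atTop, ρ t ≤ κ) → limsup ρ atTop ≤ κ := fun κ h =>
    limsup_le_of_le hcob h
  have hge : ∀ δ > 0, ∀ᶠ t in atTop, ρ t ≤ limsup ρ atTop + δ := fun δ hδ =>
    (eventually_lt_of_limsup_lt (lt_add_of_pos_right _ hδ) hbdd).mono fun _ h => h.le
  have hR1 : 1 ≤ limsup ρ atTop := le_limsup_of_frequently_le h1.frequently hbdd
  refine ⟨limsup ρ atTop, hR1, ?_, hge, hle⟩
  set R := limsup ρ atTop with hR
  have key : ∀ δ > 0, R ≤ max 1 (a * (1 - (R + δ)⁻¹)) + δ := by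
    intro δ hδ
    apply hle
    have h2 : ∀ᶠ t in atTop, ρ (t + 1) ≤ max 1 (a * (1 - (R + δ)⁻¹)) + δ := by
      filter_upwards [hrec, hge δ hδ, h1, hε.eventually (gt_mem_nhds hδ)] with t h3 h4 h5 h6
      have := one_sub_inv_mul_mono ha (by linarith) h4
      have := max_le_max_left 1 this
      linarith
    exact eventually_of_eventually_succ h2
  have hlim : Tendsto (fun δ : ℝ => max 1 (a * (1 - (R + δ)⁻¹)) + δ) (𝓝[>] 0)
      (𝓝 (max 1 (a * (1 - (R + 0)⁻¹)) + 0)) := by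
    refine Tendsto.mono_left (ContinuousAt.tendsto ?_) nhdsWithin_le_nhds
    have : R + 0 ≠ 0 := by linarith
    fun_prop (disch := assumption)
  simpa using ge_of_tendsto hlim (eventually_nhdsWithin_of_forall key)

/-- The fixed points of `ρ ↦ a (1 - 1 / ρ)` are `p` and `q`. A sequence that is driven by this map
up to `o(1)` and frequently makes a step below `b (1 - 1 / ρ)` with `b < p ^ 2` tends to `1`. -/
lemma tendsto_one_of_recursion {ρ ε : ℕ → ℝ} {a b p q M : ℝ} (hp : 1 < p) (hpq : p ≤ q)
    (hsum : p + q = a) (hprod : p * q = a) (hb0 : 0 ≤ b) (hb : b < p ^ 2)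
    (h1 : ∀ᶠ t in atTop, 1 ≤ ρ t) (hM : ∀ᶠ t in atTop, ρ t ≤ M)
    (hε : Tendsto ε atTop (𝓝 0))
    (hrec : ∀ᶠ t in atTop, ρ (t + 1) ≤ max 1 (a * (1 - (ρ t)⁻¹)) + ε t)
    (hhit : ∀ κ, 1 < κ → (∀ᶠ t in atTop, κ < ρ t) →
      ∃ᶠ t in atTop, ρ (t + 1) ≤ max 1 (b * (1 - (ρ t)⁻¹)) + ε t) :
    Tendsto ρ atTop (𝓝 1) := by
  have ha : 0 ≤ a := by nlinarith
  obtain ⟨R, hR1, hR, hRu, hRl⟩ := exists_asymptotic_bound ha h1 hM hε hrec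
  have hp0 : 0 < p := by linarith
  have hq0 : 0 < q := by linarith
  have hroot : ∀ s, 1 < s → s ≤ max 1 (a * (1 - s⁻¹)) → p ≤ s ∧ s ≤ q := by
    intro s hs hs'
    have h2 : s ≤ a * (1 - s⁻¹) := by
      rcases le_max_iff.1 hs' with h | h
      · linarith
      · exact h
    have h3 : (s - p) * (s - q) ≤ 0 := by
      have h4 : s * s ≤ a * (1 - s⁻¹) * s := by gcongr
      have h5 : a * (1 - s⁻¹) * s = a * s - a := by field_simp
      nlinarith
    constructor <;> by_contra! h <;> nlinarith
  -- Below p, the map ρ ↦ max 1 (a (1 - 1/ρ)) sends κ strictly below itself, so [1, κ] is eventually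
  -- trapping. Above b / p = b (1 - 1/q), a single slow step from near q enters it.
  obtain ⟨κ, hκ1, hκp⟩ : ∃ κ, max 1 (b / p) < κ ∧ κ < p := by
    apply exists_between
    rw [max_lt_iff, div_lt_iff₀ hp0]
    exact ⟨hp, by nlinarith⟩
  have hκ1' : 1 < κ := (le_max_left _ _).trans_lt hκ1
  have hgκ : max 1 (a * (1 - κ⁻¹)) < κ := by
    by_contra! h
    exact absurd (hroot κ hκ1' h).1 (by linarith)
  have hfreq : ∃ᶠ t in atTop, ρ t ≤ κ := by
    intro hcon
    have hκρ : ∀ᶠ t in atTop, κ < ρ t := hcon.mono fun t ht => not_le.1 ht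
    have hRq : R ≤ q := by
      rcases hR1.eq_or_lt with h | h
      · linarith
      · exact (hroot R h hR).2
    have hbq : b * (1 - q⁻¹) = b / p := by
      have h7 : p * (q - 1) = q := by linarith
      field_simp
      linear_combination b * h7
    have hlim : Tendsto (fun δ : ℝ => max 1 (b * (1 - (q + δ)⁻¹)) + δ) (𝓝[>] 0)
        (𝓝 (max 1 (b * (1 - (q + 0)⁻¹)) + 0)) := by
      refine Tendsto.mono_left (ContinuousAt.tendsto ?_) nhdsWithin_le_nhds
      have : q + 0 ≠ 0 := by linarith
      fun_prop (disch := assumption)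
    rw [add_zero, add_zero, hbq] at hlim
    obtain ⟨δ, hδ, hδ0⟩ := ((hlim.eventually (gt_mem_nhds hκ1)).and self_mem_nhdsWithin).exists
    have hδ0 : 0 < δ := hδ0
    have hκ1s : ∀ᶠ t in atTop, κ < ρ (t + 1) := (tendsto_add_atTop_nat 1).eventually hκρ
    obtain ⟨t, ht, h3, h4, h5, h6⟩ := ((hhit κ hκ1' hκρ).and_eventually
      ((hRu δ hδ0).and (h1.and (hκ1s.and (hε.eventually (gt_mem_nhds hδ0)))))).exists
    have h7 := max_le_max_left 1 (one_sub_inv_mul_mono hb0 (by linarith)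
      (show ρ t ≤ q + δ by linarith))
    linarith
  have hev : ∀ᶠ t in atTop, ρ t ≤ κ := by
    have hst : ∀ᶠ t in atTop, ρ t ≤ κ → ρ (t + 1) ≤ κ := by
      filter_upwards [hrec, h1, hε.eventually (gt_mem_nhds (sub_pos.2 hgκ))] with t h3 h4 h5 h6
      have := max_le_max_left 1 (one_sub_inv_mul_mono ha (by linarith) h6)
      linarith
    obtain ⟨N, hN⟩ := eventually_atTop.1 hst
    obtain ⟨t₀, ht₀, h⟩ := frequently_atTop.1 hfreq N
    refine eventually_atTop.2 ⟨t₀, fun t ht => ?_⟩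
    induction t, ht using Nat.le_induction with
    | base => exact h
    | succ t ht ih => exact hN t (by omega) ih
  have hR1' : R = 1 := by
    rcases hR1.eq_or_lt with h | h
    · exact h.symm
    · exact absurd (hroot R h hR).1 (by linarith [hRl κ hev])
  rw [Metric.tendsto_nhds]
  intro δ hδ
  filter_upwards [h1, hRu (δ / 2) (by linarith)] with t h2 h3
  rw [Real.dist_eq, abs_of_nonneg (by linarith)]
  linarith

/-! ### Information growth on the logarithmic scale -/

/-- Inserting |y| = √(r₁/r₀) |v| splits |y|^e into a deterministic and a noise factor. The noise
coefficient is 2a even when e < a, so that one noise term serves both for the general bound and at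
slow growth sites. -/
lemma sq_le_exp_of_growth {C a e r₀ r₁ y v z : ℝ} (hC : 1 ≤ C) (he : 0 ≤ e) (hea : e ≤ a)
    (hr₀ : 0 < r₀) (hr : r₀ ≤ r₁) (hy : |y| = √(r₁ / r₀) * |v|) (hz : |z| ≤ C * (1 + |y| ^ e)) :
    z ^ 2 ≤ Real.exp (Real.log (4 * C ^ 2) + 2 * a * Real.log (1 + |v|) +
      e * (Real.log r₁ - Real.log r₀)) := by
  have hr₁ : 0 < r₁ := hr₀.trans_le hr
  have hv : 0 ≤ |v| := abs_nonneg v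
  have hs1 : 1 ≤ √(r₁ / r₀) := by
    rw [Real.one_le_sqrt, one_le_div hr₀]; exact hr
  have hs0 : 0 < √(r₁ / r₀) := by linarith
  set s := √(r₁ / r₀) with hs
  have h1 : |y| ^ e ≤ (s * (1 + |v|)) ^ e := by
    rw [hy]; gcongr; linarith
  have h2 : 1 ≤ (s * (1 + |v|)) ^ e := Real.one_le_rpow (by nlinarith) he
  have h3 : |z| ≤ 2 * C * (s * (1 + |v|)) ^ e := by nlinarith
  have h4 : s * (1 + |v|) = Real.exp ((Real.log r₁ - Real.log r₀) / 2 + Real.log (1 + |v|)) := by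
    rw [Real.exp_add, Real.exp_log (by positivity), ← Real.log_div hr₁.ne' hr₀.ne',
      ← Real.log_sqrt (by positivity), Real.exp_log hs0]
  have hl : 0 ≤ Real.log (1 + |v|) := Real.log_nonneg (by linarith)
  calc z ^ 2 = |z| ^ 2 := (sq_abs z).symm
    _ ≤ (2 * C * (s * (1 + |v|)) ^ e) ^ 2 := by gcongr
    _ = (4 * C ^ 2) * Real.exp (((Real.log r₁ - Real.log r₀) / 2 + Real.log (1 + |v|)) * e * 2) := by
        rw [h4, ← Real.exp_mul, mul_pow, ← Real.exp_nat_mul]; push_cast; ring_nf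
    _ = Real.exp (Real.log (4 * C ^ 2) + (2 * e * Real.log (1 + |v|) +
          e * (Real.log r₁ - Real.log r₀))) := by
        rw [Real.exp_add, Real.exp_log (by positivity)]; ring_nf
    _ ≤ _ := by
        have := mul_le_mul_of_nonneg_right hea hl
        exact Real.exp_le_exp.2 (by linarith)

lemma exp_add_exp_le {x d n : ℝ} (hn : 0 ≤ n) :
    Real.exp x + Real.exp (n + d) ≤ Real.exp (max x d + (n + Real.log 2)) := by
  have h1 : Real.exp x ≤ Real.exp (max x d + n) :=
    Real.exp_le_exp.2 (by linarith [le_max_left x d])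
  have h2 : Real.exp (n + d) ≤ Real.exp (max x d + n) :=
    Real.exp_le_exp.2 (by linarith [le_max_right x d])
  rw [← add_assoc, Real.exp_add _ (Real.log 2), Real.exp_log two_pos]
  linarith

lemma tendsto_log_add_div_atTop (A B k l : ℝ) :
    Tendsto (fun u : ℝ => (A + B * Real.log (k + u)) / (l + u)) atTop (𝓝 0) := by
  have hadd : ∀ c : ℝ, Tendsto (fun u : ℝ => c + u) atTop atTop := fun c =>
    tendsto_atTop_add_const_left _ _ tendsto_id
  have hO : ∀ c c' : ℝ, (fun u : ℝ => c + u) =O[atTop] fun u => c' + u := by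
    intro c c'
    refine IsBigO.of_bound 2 ?_
    filter_upwards [eventually_ge_atTop (|c| + 2 * |c'|)] with u hu
    rw [Real.norm_eq_abs, Real.norm_eq_abs, abs_of_nonneg, abs_of_nonneg]
    · linarith [le_abs_self c, neg_abs_le c']
    · linarith [neg_abs_le c', abs_nonneg c, abs_nonneg c']
    · linarith [neg_abs_le c, abs_nonneg c']
  have h1 : (fun u : ℝ => Real.log (k + u)) =o[atTop] fun u => l + u :=
    (Real.isLittleO_log_id_atTop.comp_tendsto (hadd k)).trans_isBigO (hO k l)
  have h2 : (fun _ : ℝ => A) =o[atTop] fun u => l + u :=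
    isLittleO_const_left.2 (Or.inr (tendsto_norm_atTop_atTop.comp (hadd l)))
  exact (h2.add (h1.const_mul_left B)).tendsto_div_nhds_zero

/-- The hypotheses give |v t| ≤ log K + log t, so the numerator is O(log log t), whereas log (r t) ≥
log c + log t. -/
lemma tendsto_noise_div_log {A B K c : ℝ} {v r : ℕ → ℝ} (hA : 0 ≤ A) (hB : 0 ≤ B)
    (hv : ∀ t : ℕ, 1 ≤ t → Real.exp |v t| ≤ K * t) (hc : 0 < c)
    (hr : ∀ᶠ t : ℕ in atTop, c * t ≤ r t) :
    Tendsto (fun t => (A + B * Real.log (1 + |v t|)) / Real.log (r t)) atTop (𝓝 0) := by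
  have hlog : Tendsto (fun t : ℕ => Real.log (t : ℝ)) atTop atTop :=
    Real.tendsto_log_atTop.comp tendsto_natCast_atTop_atTop
  have hK : 0 < K := by
    have := (Real.exp_pos _).trans_le (hv 1 le_rfl)
    simpa using this
  refine squeeze_zero' ?_ ?_
    ((tendsto_log_add_div_atTop A B (1 + Real.log K) (Real.log c)).comp hlog)
  · filter_upwards [hr, (tendsto_atTop_add_const_left _ (Real.log c) hlog).eventually_gt_atTop 0,
      eventually_gt_atTop 0] with t h1 h2 h3
    have ht : (0 : ℝ) < t := by exact_mod_cast h3
    have h4 : 0 ≤ Real.log (1 + |v t|) := Real.log_nonneg (by linarith [abs_nonneg (v t)])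
    have h5 : 0 ≤ Real.log (r t) := by
      have := Real.log_le_log (by positivity) h1
      rw [Real.log_mul hc.ne' ht.ne'] at this
      linarith
    positivity
  · filter_upwards [hr, (tendsto_atTop_add_const_left _ (Real.log c) hlog).eventually_gt_atTop 0,
      eventually_gt_atTop 0] with t h1 h2 h3
    have ht : (0 : ℝ) < t := by exact_mod_cast h3
    have h5 := Real.log_le_log (by positivity) h1
    rw [Real.log_mul hc.ne' ht.ne'] at h5
    have h6 := Real.log_le_log (Real.exp_pos _) (hv t h3)
    rw [Real.log_exp, Real.log_mul hK.ne' ht.ne'] at h6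
    have h7 : Real.log (1 + |v t|) ≤ Real.log (1 + Real.log K + Real.log t) :=
      Real.log_le_log (by positivity) (by linarith)
    have h8 : 0 ≤ Real.log (1 + |v t|) := Real.log_nonneg (by linarith [abs_nonneg (v t)])
    simp only [Function.comp]
    gcongr
    nlinarith

/-- If `x` grows at most geometrically, then `log x` grows at most linearly. -/
lemma exists_log_le_linear {x : ℕ → ℝ} {M : ℝ} (hM : 1 ≤ M) (hx : ∀ᶠ t in atTop, 0 < x t)
    (hstep : ∀ᶠ t in atTop, x (t + 1) ≤ M * x t) :
    ∃ D, ∀ᶠ t : ℕ in atTop, Real.log (x t) ≤ D * t := by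
  obtain ⟨N, hN⟩ := eventually_atTop.1 (hx.and hstep)
  have hl : 0 ≤ Real.log M := Real.log_nonneg hM
  have h1 : ∀ t ≥ N, Real.log (x t) ≤ |Real.log (x N)| + Real.log M * t := by
    intro t ht
    induction t, ht using Nat.le_induction with
    | base => linarith [le_abs_self (Real.log (x N)), mul_nonneg hl (Nat.cast_nonneg (α := ℝ) N)]
    | succ t ht ih =>
      have h2 := Real.log_le_log (hN (t + 1) (by omega)).1 (hN t ht).2
      rw [Real.log_mul (by linarith) (hN t ht).1.ne'] at h2
      push_cast
      linarith
  refine ⟨|Real.log (x N)| + Real.log M, ?_⟩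
  filter_upwards [eventually_ge_atTop N, eventually_ge_atTop 1] with t h2 h3
  have h4 : (1 : ℝ) ≤ t := by exact_mod_cast h3
  nlinarith [h1 t h2, abs_nonneg (Real.log (x N))]

/-- The pathwise part of the stability argument: `r t` is the inverse of the least-squares
variance, `v` is the innovation sequence, and slow growth sites are visited infinitely often
whenever the outputs explode. -/
theorem variance_ratio_bounded {f : ℝ → ℝ} {S : Set ℝ} {r y v : ℕ → ℝ} {a b p q C K c : ℝ}
    (hC : 1 ≤ C) (hp : 1 < p) (hpq : p ≤ q) (hsum : p + q = a) (hprod : p * q = a)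
    (hb0 : 0 ≤ b) (hba : b ≤ a) (hb : b < p ^ 2)
    (hr0 : ∀ t, 0 < r t) (hr : ∀ t, r (t + 1) = r t + f (y t) ^ 2)
    (hy : ∀ t, |y (t + 1)| = √(r (t + 1) / r t) * |v (t + 1)|)
    (hf : ∀ x, |f x| ≤ C * (1 + |x| ^ a)) (hS : ∀ x ∈ S, |f x| ≤ C * (1 + |x| ^ b))
    (hv : ∀ t : ℕ, 1 ≤ t → Real.exp |v t| ≤ K * t) (hc : 0 < c)
    (hgrow : ∀ᶠ t : ℕ in atTop, c * t ≤ r t)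
    (hhit : Tendsto (fun t => √(r (t + 1) / r t)) atTop atTop →
      (∃ D : ℝ, ∀ᶠ t : ℕ in atTop, Real.log (Real.log √(r (t + 1) / r t)) ≤ D * (t + 1 : ℕ)) →
      ∃ᶠ t in atTop, y (t + 1) ∈ S) :
    ∃ M, ∀ t, r (t + 1) / r t ≤ M := by
  have ha : 0 ≤ a := hb0.trans hba
  set x : ℕ → ℝ := fun t => Real.log (r t) with hx
  set m : ℕ → ℝ := fun t => Real.log (4 * C ^ 2) + 2 * a * Real.log (1 + |v t|) with hm
  have hlC : 0 ≤ Real.log (4 * C ^ 2) := Real.log_nonneg (by nlinarith)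
  have hm0 : ∀ t, 0 ≤ m t := fun t => by
    have : 0 ≤ Real.log (1 + |v t|) := Real.log_nonneg (by linarith [abs_nonneg (v t)])
    positivity
  have hexpx : ∀ t, Real.exp (x t) = r t := fun t => Real.exp_log (hr0 t)
  have hmono : ∀ t, r t ≤ r (t + 1) := fun t => by rw [hr]; nlinarith [sq_nonneg (f (y t))]
  have hxmono : ∀ t, x t ≤ x (t + 1) := fun t => Real.log_le_log (hr0 t) (hmono t)
  have hsq : ∀ t, f (y (t + 1)) ^ 2 ≤ Real.exp (m (t + 1) + a * (x (t + 1) - x t)) := fun t =>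
    sq_le_exp_of_growth hC ha le_rfl (hr0 t) (hmono t) (hy t) (hf _)
  have hstep : ∀ t d, f (y (t + 1)) ^ 2 ≤ Real.exp (m (t + 1) + d) →
      x (t + 2) ≤ max (x (t + 1)) d + (m (t + 1) + Real.log 2) := by
    intro t d h
    rw [← Real.exp_le_exp, hexpx, hr (t + 1), ← hexpx (t + 1)]
    exact (add_le_add_right h _).trans (exp_add_exp_le (hm0 _))
  have hxtop : Tendsto x atTop atTop := by
    refine Real.tendsto_log_atTop.comp (tendsto_atTop_mono' _ hgrow ?_)
    exact tendsto_natCast_atTop_atTop.const_mul_atTop hc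
  have hε : Tendsto (fun t => (m t + Real.log 2) / x t) atTop (𝓝 0) := by
    have := tendsto_noise_div_log (A := Real.log (4 * C ^ 2) + Real.log 2) (B := 2 * a)
      (by positivity) (by positivity) hv hc hgrow
    refine this.congr fun t => ?_
    simp only [hm, hx]; ring
  have hε1 := hε.comp (tendsto_add_atTop_nat 1)
  have hxpos : ∀ᶠ t in atTop, 0 < x t := hxtop.eventually_gt_atTop 0
  set ρ : ℕ → ℝ := fun t => x (t + 1) / x t with hρ
  have hρ1 : ∀ᶠ t in atTop, 1 ≤ ρ t := by
    filter_upwards [hxpos] with t h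
    exact (one_le_div h).2 (hxmono t)
  -- The exponent e is left free: e = a is always admissible, e = b only when `y (t + 1)` lies in
  -- `S`.
  have hrec : ∀ᶠ t in atTop, ∀ e, 0 ≤ e →
      f (y (t + 1)) ^ 2 ≤ Real.exp (m (t + 1) + e * (x (t + 1) - x t)) →
      ρ (t + 1) ≤ max 1 (e * (1 - (ρ t)⁻¹)) + (m (t + 1) + Real.log 2) / x (t + 1) := by
    filter_upwards [hxpos] with t h e he h1
    have h' : 0 < x (t + 1) := h.trans_le (hxmono t)
    have h2 := hstep t _ h1
    simp only [hρ]
    rw [div_le_iff₀ h', add_mul, div_mul_cancel₀ _ h'.ne', max_mul_of_nonneg _ _ h'.le]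
    refine h2.trans_eq ?_
    congr 2
    · ring
    · field_simp
  have hM : ∀ᶠ t in atTop, ρ t ≤ max 1 a + 1 := by
    have h1 : ∀ᶠ t in atTop, ρ (t + 1) ≤ max 1 a + 1 := by
      filter_upwards [hrec, hρ1, hε1.eventually (gt_mem_nhds one_pos)] with t h1 h2 h3
      have h4 := h1 a ha (hsq t)
      have h5 : a * (1 - (ρ t)⁻¹) ≤ a := by
        have : 0 ≤ (ρ t)⁻¹ := by positivity
        nlinarith
      have h6 := max_le_max_left 1 h5
      simp only [Function.comp] at h3
      linarith
    exact eventually_of_eventually_succ h1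
  have hlim : Tendsto ρ atTop (𝓝 1) := by
    refine tendsto_one_of_recursion hp hpq hsum hprod hb0 hb hρ1 hM hε1
      (hrec.mono fun t h => h a ha (hsq t)) ?_
    intro κ hκ hκρ
    have hsqrt : ∀ t, √(r (t + 1) / r t) = Real.exp ((x (t + 1) - x t) / 2) := by
      intro t
      rw [← Real.log_div (hr0 _).ne' (hr0 _).ne', ← Real.log_sqrt (div_pos (hr0 _) (hr0 _)).le,
        Real.exp_log (Real.sqrt_pos.2 (div_pos (hr0 _) (hr0 _)))]
    -- If ρ stays above κ > 1, each increment of x is at least (κ - 1) x_t, so the standard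
    -- deviations explode.
    have hdiff : ∀ᶠ t in atTop, (κ - 1) / 2 * x t ≤ (x (t + 1) - x t) / 2 := by
      filter_upwards [hκρ, hxpos] with t h1 h2
      have := (lt_div_iff₀ h2).1 h1
      linarith
    have hdtop : Tendsto (fun t => (x (t + 1) - x t) / 2) atTop atTop :=
      tendsto_atTop_mono' _ hdiff (hxtop.const_mul_atTop (by linarith))
    have hfreq : ∃ᶠ t in atTop, y (t + 1) ∈ S := by
      refine hhit ?_ ?_
      · simp_rw [hsqrt]
        exact Real.tendsto_exp_atTop.comp hdtop
      -- Bounded ρ means at most geometric growth of x, and log σ_t ≤ x_{t+1}; hence log log σ_t is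
      -- at most linear in t.
      · obtain ⟨D, hD⟩ := exists_log_le_linear (M := max 1 a + 1)
          (by linarith [le_max_left 1 a]) hxpos (by
            filter_upwards [hM, hxpos] with t h1 h2
            exact (div_le_iff₀ h2).1 h1)
        refine ⟨D, ?_⟩
        filter_upwards [(tendsto_add_atTop_nat 1).eventually hD, hdtop.eventually_gt_atTop 0,
          hxpos] with t h1 h2 h3
        rw [hsqrt, Real.log_exp]
        refine le_trans (Real.log_le_log h2 ?_) h1
        linarith [hxmono t]
    refine (hfreq.and_eventually hrec).mono fun t ht => ht.2 b hb0 ?_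
    exact sq_le_exp_of_growth hC hb0 hba (hr0 t) (hmono t) (hy t) (hS _ ht.1)
  -- The threshold 1 + 1/(2(a+1)) makes a (x_{t+1} - x_t) ≤ x_t / 2. The noise takes at most x_{t+1}
  -- / 2, so f(y_{t+1})² ≤ r_{t+1}.
  have hfin : ∀ᶠ t in atTop, r (t + 1 + 1) / r (t + 1) ≤ 2 := by
    filter_upwards [hlim.eventually (gt_mem_nhds (show 1 < 1 + 1 / (2 * (a + 1)) by
        have : 0 < a + 1 := by linarith
        simp; positivity)), hxpos, hε1.eventually (gt_mem_nhds (show (0 : ℝ) < 1 / 2 by norm_num))]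
      with t h1 h2 h3
    have h' : 0 < x (t + 1) := h2.trans_le (hxmono t)
    simp only [Function.comp] at h3
    rw [div_lt_iff₀ h'] at h3
    simp only [hρ] at h1
    rw [div_lt_iff₀ h2] at h1
    have h4 : a * (x (t + 1) - x t) ≤ 1 / 2 * x t := by
      have h5 : x (t + 1) - x t ≤ 1 / (2 * (a + 1)) * x t := by linarith
      calc a * (x (t + 1) - x t) ≤ (a + 1) * (1 / (2 * (a + 1)) * x t) := by
            gcongr
            · linarith [hxmono t]
            · linarith
        _ = 1 / 2 * x t := by
            have : a + 1 ≠ 0 := by linarith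
            field_simp
    have h6 : f (y (t + 1)) ^ 2 ≤ r (t + 1) := by
      rw [← hexpx (t + 1)]
      refine (hsq t).trans (Real.exp_le_exp.2 ?_)
      linarith [hxmono t, Real.log_nonneg (show (1 : ℝ) ≤ 2 by norm_num)]
    rw [div_le_iff₀ (hr0 _), hr (t + 1)]
    linarith
  have hbd : IsBoundedUnder (· ≤ ·) atTop fun t => r (t + 1) / r t := by
    exact ⟨2, eventually_map.2 (eventually_of_eventually_succ
      (P := fun t => r (t + 1) / r t ≤ 2) hfin)⟩
  obtain ⟨M, hM'⟩ := hbd.bddAbove_range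
  exact ⟨M, fun t => hM' ⟨t, rfl⟩⟩

/-! ### Algebra of the least-squares recursion -/

section LeastSquares

variable {f : ℝ → ℝ} {θ₀ P₀ : ℝ}

/-- Non-anticipation: this allows a path to be replaced by its frozen history. -/
lemma lsState_congr {t : ℕ} {p p' : ℕ → ℝ} (h : ∀ i ≤ t, p i = p' i) :
    lsState f θ₀ P₀ p t = lsState f θ₀ P₀ p' t := by
  induction t with
  | zero => rfl
  | succ t ih =>
    rw [lsState, lsState, ih fun i hi => h i (by omega), h t (by omega), h (t + 1) le_rfl]

lemma measurable_lsState {Ω : Type*} {m : MeasurableSpace Ω} (hf : Measurable f) {t : ℕ}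
    {y : ℕ → Ω → ℝ} (hy : ∀ i ≤ t, Measurable (y i)) :
    Measurable fun ω => lsState f θ₀ P₀ (fun i => y i ω) t := by
  induction t with
  | zero => exact measurable_const
  | succ t ih =>
    have h1 := ih fun i hi => hy i (by omega)
    have h2 : Measurable fun ω => f (y t ω) := hf.comp (hy t (by omega))
    have h3 := hy (t + 1) le_rfl
    have h4 : Measurable fun z : (ℝ × ℝ) × ℝ × ℝ × ℝ => lsStep z.1 z.2.1 z.2.2.1 z.2.2.2 := by
      simp only [lsStep]
      fun_prop
    exact h4.comp (h1.prodMk (h2.prodMk ((h1.fst.neg.mul h2).prodMk h3)))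

lemma lsState_snd_pos (hP : 0 < P₀) (p : ℕ → ℝ) (t : ℕ) : 0 < (lsState f θ₀ P₀ p t).2 := by
  induction t with
  | zero => exact hP
  | succ t ih =>
    simp only [lsState, lsStep]
    set P := (lsState f θ₀ P₀ p t).2
    have h : 0 < 1 + f (p t) * P * f (p t) := by nlinarith [mul_self_nonneg (f (p t))]
    have : P - (1 + f (p t) * P * f (p t))⁻¹ * P * f (p t) * f (p t) * P
        = P / (1 + f (p t) * P * f (p t)) := by field_simp; ring
    rw [this]; positivity

/-- The variance update is P / (1 + P φ²), so precisions add. -/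
lemma inv_lsState_snd_succ (hP : 0 < P₀) (p : ℕ → ℝ) (t : ℕ) :
    ((lsState f θ₀ P₀ p (t + 1)).2)⁻¹ = ((lsState f θ₀ P₀ p t).2)⁻¹ + f (p t) ^ 2 := by
  have hpos := lsState_snd_pos (f := f) (θ₀ := θ₀) hP p t
  simp only [lsState, lsStep]
  set P := (lsState f θ₀ P₀ p t).2
  have h : 0 < 1 + f (p t) * P * f (p t) := by nlinarith [mul_self_nonneg (f (p t))]
  have : P - (1 + f (p t) * P * f (p t))⁻¹ * P * f (p t) * f (p t) * P
      = P / (1 + f (p t) * P * f (p t)) := by field_simp; ring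
  rw [this, inv_div]; field_simp

/-- The conditional standard deviation of `y (t+1)` given the outputs up to time `t`. -/
noncomputable def predSigma (f : ℝ → ℝ) (θ₀ P₀ : ℝ) (t : ℕ) (p : ℕ → ℝ) : ℝ :=
  √(1 + (lsState f θ₀ P₀ p t).2 * f (p t) ^ 2)

lemma predSigma_congr {t : ℕ} {p p' : ℕ → ℝ} (h : ∀ i ≤ t, p i = p' i) :
    predSigma f θ₀ P₀ t p = predSigma f θ₀ P₀ t p' := by
  rw [predSigma, predSigma, lsState_congr h, h t le_rfl]

lemma measurable_predSigma {Ω : Type*} {m : MeasurableSpace Ω} (hf : Measurable f) {t : ℕ}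
    {y : ℕ → Ω → ℝ} (hy : ∀ i ≤ t, Measurable (y i)) :
    Measurable fun ω => predSigma f θ₀ P₀ t (fun i => y i ω) := by
  have h1 := measurable_lsState (θ₀ := θ₀) (P₀ := P₀) hf hy
  have h2 : Measurable fun ω => f (y t ω) := hf.comp (hy t le_rfl)
  exact (measurable_const.add (h1.snd.mul (h2.pow_const 2))).sqrt

lemma one_le_predSigma (hP : 0 < P₀) (t : ℕ) (p : ℕ → ℝ) : 1 ≤ predSigma f θ₀ P₀ t p := by
  have := lsState_snd_pos (f := f) (θ₀ := θ₀) hP p t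
  rw [predSigma, Real.one_le_sqrt]
  nlinarith [sq_nonneg (f (p t))]

lemma predSigma_eq_sqrt_div (hP : 0 < P₀) (t : ℕ) (p : ℕ → ℝ) :
    predSigma f θ₀ P₀ t p =
      √(((lsState f θ₀ P₀ p (t + 1)).2)⁻¹ / ((lsState f θ₀ P₀ p t).2)⁻¹) := by
  have := lsState_snd_pos (f := f) (θ₀ := θ₀) hP p t
  rw [predSigma, inv_lsState_snd_succ hP]
  congr 1
  field_simp

/-- The normalized estimation error `(θ - θ_t) / √P_t`. -/
noncomputable def normError (f : ℝ → ℝ) (θ₀ P₀ ϑ : ℝ) (t : ℕ) (p : ℕ → ℝ) : ℝ :=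
  (ϑ - (lsState f θ₀ P₀ p t).1) / √(lsState f θ₀ P₀ p t).2

lemma measurable_normError {Ω : Type*} {m : MeasurableSpace Ω} (hf : Measurable f) {t : ℕ}
    {ϑ : Ω → ℝ} {y : ℕ → Ω → ℝ} (hϑ : Measurable ϑ) (hy : ∀ i ≤ t, Measurable (y i)) :
    Measurable fun ω => normError f θ₀ P₀ (ϑ ω) t (fun i => y i ω) := by
  have h := measurable_lsState (θ₀ := θ₀) (P₀ := P₀) hf hy
  exact (hϑ.sub h.fst).div h.snd.sqrt

/-- One step of the closed loop rotates the pair (normalized error, noise) into the pair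
(new normalized error, normalized output). -/
lemma rotation_normError (hP : 0 < P₀) {ϑ W : ℝ} {t : ℕ} {p : ℕ → ℝ}
    (hp : p (t + 1) = ϑ * f (p t) + lsController f θ₀ P₀ t p + W) :
    ContinuousLinearMap.rotation (-Real.arctan (√(lsState f θ₀ P₀ p t).2 * f (p t)))
        (normError f θ₀ P₀ ϑ t p, W) =
      (normError f θ₀ P₀ ϑ (t + 1) p, p (t + 1) / predSigma f θ₀ P₀ t p) := by
  have hpos := lsState_snd_pos (f := f) (θ₀ := θ₀) hP p t
  have h1 := one_le_predSigma (f := f) (θ₀ := θ₀) hP t p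
  have hs : predSigma f θ₀ P₀ t p ^ 2 = 1 + (lsState f θ₀ P₀ p t).2 * f (p t) ^ 2 :=
    Real.sq_sqrt (by positivity)
  have hk : √(1 + (√(lsState f θ₀ P₀ p t).2 * f (p t)) ^ 2) = predSigma f θ₀ P₀ t p := by
    rw [predSigma, mul_pow, Real.sq_sqrt hpos.le]
  have hP' : (lsState f θ₀ P₀ p (t + 1)).2 =
      (lsState f θ₀ P₀ p t).2 / predSigma f θ₀ P₀ t p ^ 2 := by
    rw [← inv_inj, inv_lsState_snd_succ hP, inv_div, hs]
    field_simp
  have hq : √(lsState f θ₀ P₀ p (t + 1)).2 =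
      √(lsState f θ₀ P₀ p t).2 / predSigma f θ₀ P₀ t p := by
    rw [hP', Real.sqrt_div hpos.le, Real.sqrt_sq (by linarith)]
  rw [ContinuousLinearMap.rotation_apply, normError, normError, hq, Real.cos_neg, Real.sin_neg,
    Real.cos_arctan, Real.sin_arctan, hk]
  simp only [lsState, lsStep]
  rw [hp, lsController]
  have hq0 : 0 < √(lsState f θ₀ P₀ p t).2 := Real.sqrt_pos.2 hpos
  have hq2 : √(lsState f θ₀ P₀ p t).2 ^ 2 = (lsState f θ₀ P₀ p t).2 := Real.sq_sqrt hpos.le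
  have hden : 1 + f (p t) * (lsState f θ₀ P₀ p t).2 * f (p t) = predSigma f θ₀ P₀ t p ^ 2 := by
    rw [hs]; ring
  rw [hden]
  generalize predSigma f θ₀ P₀ t p = s at *
  generalize √(lsState f θ₀ P₀ p t).2 = Q at *
  rw [← hq2] at hs ⊢
  generalize (lsState f θ₀ P₀ p t).1 = T at *
  generalize f (p t) = φ at *
  have hs0 : s ≠ 0 := by positivity
  have hQ0 : Q ≠ 0 := hq0.ne'
  simp only [smul_eq_mul, Prod.mk.injEq]
  constructor
  · field_simp
    linear_combination (-(ϑ - T)) * hs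
  · field_simp
    ring

end LeastSquares

/-! ### Independence and Gaussian rotations -/

section Independence

variable {Ω α β γ : Type*} [MeasurableSpace Ω] [MeasurableSpace α] [MeasurableSpace β]
  [MeasurableSpace γ] {μ : Measure Ω} [IsProbabilityMeasure μ]

/-- The law of (A, (B, C)) is a threefold product measure; reassociating it separates C from (A, B).
-/
lemma indepFun_prodMk_left {A : Ω → α} {B : Ω → β} {C : Ω → γ} (hA : Measurable A)
    (hB : Measurable B) (hC : Measurable C) (h : IndepFun A (fun ω => (B ω, C ω)) μ)
    (h' : IndepFun B C μ) : IndepFun (fun ω => (A ω, B ω)) C μ := by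
  have hAB : IndepFun A B μ := h.comp (φ := id) (ψ := Prod.fst) measurable_id measurable_fst
  have := Measure.isProbabilityMeasure_map (μ := μ) hA.aemeasurable
  have := Measure.isProbabilityMeasure_map (μ := μ) hB.aemeasurable
  have := Measure.isProbabilityMeasure_map (μ := μ) hC.aemeasurable
  rw [indepFun_iff_map_prod_eq_prod_map_map hA.aemeasurable (by fun_prop)] at h hAB
  rw [indepFun_iff_map_prod_eq_prod_map_map hB.aemeasurable (by fun_prop)] at h'
  rw [indepFun_iff_map_prod_eq_prod_map_map (by fun_prop) hC.aemeasurable, hAB]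
  rw [h', ← Measure.prodAssoc_prod] at h
  have h2 := congrArg (Measure.map MeasurableEquiv.prodAssoc.symm) h
  rw [Measure.map_map (by fun_prop) (by fun_prop), Measure.map_map (by fun_prop) (by fun_prop)]
    at h2
  simp only [MeasurableEquiv.symm_comp_self, Measure.map_id] at h2
  exact h2

lemma map_rotation_gaussianReal (s : ℝ) :
    ((gaussianReal 0 1).prod (gaussianReal 0 1)).map (ContinuousLinearMap.rotation s) =
      (gaussianReal 0 1).prod (gaussianReal 0 1) :=
  IsGaussian.map_rotation_eq_self (by simp) s

end Independence

/-- The path `p` frozen after time `t`. -/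
def frozenPath (t : ℕ) (p : ℕ → ℝ) : ℕ → ℝ := fun i => p (min i t)

lemma measurable_history {Ω : Type*} {m : MeasurableSpace Ω} {f : ℝ → ℝ} {θ₀ P₀ : ℝ}
    (hf : Measurable f) {t : ℕ} {ϑ : Ω → ℝ} {y : ℕ → Ω → ℝ} (hϑ : Measurable ϑ)
    (hy : ∀ i ≤ t, Measurable (y i)) :
    Measurable fun ω => (frozenPath t (fun i => y i ω),
      normError f θ₀ P₀ (ϑ ω) t (fun i => y i ω)) :=
  (measurable_pi_lambda _ fun _ => hy _ (min_le_right _ _)).prodMk (measurable_normError hf hϑ hy)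

/-- The σ-algebra `m` is arbitrary: besides the ambient one, it will be the one generated by the
initial value, the parameter and the noise up to time n. -/
lemma measurable_output_of_le {Ω : Type*} {m : MeasurableSpace Ω} {f : ℝ → ℝ} {w : ℕ → Ω → ℝ}
    {θ : Ω → ℝ} {θ₀ P₀ : ℝ} {y : ℕ → Ω → ℝ} (hf : Measurable f)
    (hstep : ∀ t ω, y (t + 1) ω =
      θ ω * f (y t ω) + lsController f θ₀ P₀ t (fun i => y i ω) + w (t + 1) ω)
    (hθ : Measurable θ) (hy0 : Measurable (y 0)) {n : ℕ} (hw : ∀ i < n, Measurable (w (i + 1))) :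
    ∀ i ≤ n, Measurable (y i) := by
  intro i
  induction i using Nat.strong_induction_on with
  | _ i ih =>
    intro hi
    cases i with
    | zero => exact hy0
    | succ i =>
      have h1 := measurable_lsState (θ₀ := θ₀) (P₀ := P₀) hf (y := y) (t := i)
        fun j hj => ih j (by omega) (by omega)
      have h2 : Measurable fun ω => f (y i ω) := hf.comp (ih i (by omega) (by omega))
      have h3 := hw i (by omega)
      rw [funext (hstep i)]
      exact ((hθ.mul h2).add (h1.fst.neg.mul h2)).add h3

lemma measurable_output {Ω : Type*} [MeasurableSpace Ω] {μ : Measure Ω} {f : ℝ → ℝ}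
    {w : ℕ → Ω → ℝ} {θ : Ω → ℝ} {θ₀ : ℝ} {P₀ : ℝ≥0} {y : ℕ → Ω → ℝ} (hf : Measurable f)
    (hw : IsStandardGaussianNoise μ w) (hθ : IsGaussianParameter μ w θ θ₀ P₀)
    (hy : IsClosedLoopOutput μ f θ w (lsController f θ₀ P₀) y) (i : ℕ) : Measurable (y i) :=
  measurable_output_of_le hf hy.step hθ.measurable hy.measurable_init
    (n := i) (fun j _ => hw.measurable j) i le_rfl

/-! ### The posterior law and the innovations -/

section Innovation

variable {Ω : Type*} [MeasurableSpace Ω] {μ : Measure Ω} [IsProbabilityMeasure μ]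
  {f : ℝ → ℝ} {w : ℕ → Ω → ℝ} {θ : Ω → ℝ} {θ₀ : ℝ} {P₀ : ℝ≥0} {y : ℕ → Ω → ℝ}

/-- The history up to time t is a function of y_0, θ and w_1, …, w_t, which are jointly independent
of w_{t+1}. -/
lemma indepFun_history_noise (hf : Measurable f) (hw : IsStandardGaussianNoise μ w)
    (hθ : IsGaussianParameter μ w θ θ₀ P₀)
    (hy : IsClosedLoopOutput μ f θ w (lsController f θ₀ P₀) y) (t : ℕ) :
    IndepFun (fun ω => (frozenPath t (fun i => y i ω),
      normError f θ₀ P₀ (θ ω) t (fun i => y i ω))) (w (t + 1)) μ := by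
  have hwm := hw.measurable
  have hθm := hθ.measurable
  have hy0m := hy.measurable_init
  set W : Ω → (Finset.range t → ℝ) := fun ω i => w (i + 1) ω with hW
  have hWm : Measurable W := measurable_pi_lambda _ fun i => hwm i
  have h1 : IndepFun W (w (t + 1)) μ :=
    (hw.indep.indepFun_finset (Finset.range t) {t} (by simp) hwm).comp (φ := id)
      (ψ := fun g : ({t} : Finset ℕ) → ℝ => g ⟨t, by simp⟩) measurable_id (measurable_pi_apply _)
  have h2 : IndepFun (fun ω => (θ ω, W ω)) (w (t + 1)) μ := by
    refine indepFun_prodMk_left hθm hWm (hwm t) ?_ h1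
    exact hθ.indep.comp (φ := id) (ψ := fun g : ℕ → ℝ => ((fun i : Finset.range t => g i), g t))
      measurable_id (by fun_prop)
  have h3 : IndepFun (fun ω => (y 0 ω, (θ ω, W ω))) (w (t + 1)) μ := by
    refine indepFun_prodMk_left hy0m (by fun_prop) (hwm t) ?_ h2
    exact hy.indep_init.comp (φ := id)
      (ψ := fun g : ℝ × (ℕ → ℝ) => ((g.1, fun i : Finset.range t => g.2 i), g.2 t))
      measurable_id (by fun_prop)
  rw [IndepFun_iff_Indep] at h3 ⊢
  refine indep_of_indep_of_le_left h3 (measurable_iff_comap_le.1 ?_)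
  set Z := fun ω => (y 0 ω, (θ ω, W ω)) with hZ
  have hZm : Measurable[MeasurableSpace.comap Z inferInstance] Z := comap_measurable Z
  have e0 : Measurable[MeasurableSpace.comap Z inferInstance] (y 0) := measurable_fst.comp hZm
  have e1 : Measurable[MeasurableSpace.comap Z inferInstance] θ :=
    measurable_fst.comp (measurable_snd.comp hZm)
  have e2 : ∀ i < t, Measurable[MeasurableSpace.comap Z inferInstance] (w (i + 1)) := by
    intro i hi
    exact (measurable_pi_apply (⟨i, by simpa using hi⟩ : Finset.range t)).comp
      (measurable_snd.comp (measurable_snd.comp hZm))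
  have e3 := measurable_output_of_le hf hy.step e1 e0 e2
  exact measurable_history hf e1 e3

/-- The innovation `y (t+1) / σ_t`, where `σ_t` is the predicted standard deviation. -/
noncomputable def innovation (f : ℝ → ℝ) (θ₀ P₀ : ℝ) (t : ℕ) (p : ℕ → ℝ) : ℝ :=
  p (t + 1) / predSigma f θ₀ P₀ t p

/-- Given the history, the normalized error and the new noise form a standard Gaussian pair, and one
closed-loop step rotates it by an angle fixed by the history. Rotation invariance, applied fibrewise
as a skew product, preserves the product law. -/
lemma map_rotated (hf : Measurable f) (hw : IsStandardGaussianNoise μ w) (hP : 0 < P₀)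
    (hθ : IsGaussianParameter μ w θ θ₀ P₀)
    (hy : IsClosedLoopOutput μ f θ w (lsController f θ₀ P₀) y) (t : ℕ)
    (ih : μ.map (fun ω => (frozenPath t (fun i => y i ω),
        normError f θ₀ P₀ (θ ω) t (fun i => y i ω))) =
      (μ.map fun ω => frozenPath t (fun i => y i ω)).prod (gaussianReal 0 1)) :
    μ.map (fun ω => (frozenPath t (fun i => y i ω),
        (normError f θ₀ P₀ (θ ω) (t + 1) (fun i => y i ω),
          innovation f θ₀ P₀ t (fun i => y i ω)))) =
      (μ.map fun ω => frozenPath t (fun i => y i ω)).prod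
        ((gaussianReal 0 1).prod (gaussianReal 0 1)) := by
  have hym := measurable_output hf hw hθ hy
  have hYm : Measurable fun ω => frozenPath t (fun i => y i ω) :=
    measurable_pi_lambda _ fun i => hym _
  have hEm : Measurable fun ω => normError f θ₀ P₀ (θ ω) t (fun i => y i ω) :=
    measurable_normError hf hθ.measurable fun i _ => hym i
  have hprob := Measure.isProbabilityMeasure_map (μ := μ) hYm.aemeasurable
  have h1 := (indepFun_iff_map_prod_eq_prod_map_map (hYm.prodMk hEm).aemeasurable
    (hw.measurable t).aemeasurable).1 (indepFun_history_noise hf hw hθ hy t)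
  rw [ih, hw.law t] at h1
  have h2 := congrArg (Measure.map MeasurableEquiv.prodAssoc) h1
  have hwm := hw.measurable t
  rw [Measure.prodAssoc_prod, Measure.map_map (by fun_prop) (by fun_prop)] at h2
  have hang : Measurable fun p : ℕ → ℝ =>
      -Real.arctan (√(lsState f θ₀ P₀ p t).2 * f (p t)) := by
    have h3 := measurable_lsState (θ₀ := θ₀) (P₀ := P₀) hf (t := t)
      (y := fun i (p : ℕ → ℝ) => p i) fun i _ => measurable_pi_apply i
    have h4 : Measurable fun p : ℕ → ℝ => f (p t) := hf.comp (measurable_pi_apply t)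
    have h5 := (h3.snd.sqrt).mul h4
    exact (Real.measurable_arctan.comp h5).neg
  have hskew := (MeasurePreserving.id (μ.map fun ω => frozenPath t (fun i => y i ω))).skew_product
    (g := fun p => ContinuousLinearMap.rotation
      (-Real.arctan (√(lsState f θ₀ P₀ p t).2 * f (p t))))
    (μc := (gaussianReal 0 1).prod (gaussianReal 0 1))
    (μd := (gaussianReal 0 1).prod (gaussianReal 0 1)) (by
      simp only [Function.uncurry_def, ContinuousLinearMap.rotation_apply]
      have : Measurable fun p : (ℕ → ℝ) × ℝ × ℝ =>
          -Real.arctan (√(lsState f θ₀ P₀ p.1 t).2 * f (p.1 t)) := hang.comp measurable_fst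
      fun_prop) (ae_of_all _ fun p => map_rotation_gaussianReal _)
  rw [← hskew.map_eq]
  conv_rhs => rw [← h2]
  rw [Measure.map_map hskew.measurable (by fun_prop)]
  congr 1
  funext ω
  have hfz : ∀ i ≤ t, frozenPath t (fun i => y i ω) i = y i ω := fun i hi => by
    simp [frozenPath, hi]
  change _ = (frozenPath t (fun i => y i ω), ContinuousLinearMap.rotation
    (-Real.arctan (√(lsState f θ₀ P₀ (frozenPath t (fun i => y i ω)) t).2 *
      f (frozenPath t (fun i => y i ω) t)))
    (normError f θ₀ P₀ (θ ω) t (fun i => y i ω), w (t + 1) ω))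
  rw [lsState_congr hfz, hfz t le_rfl, rotation_normError (by exact_mod_cast hP) (hy.step t ω)]
  rfl

/-- The posterior law: the normalized estimation error is standard normal and independent of the
outputs observed so far. -/
lemma map_history_normError (hf : Measurable f) (hw : IsStandardGaussianNoise μ w) (hP : 0 < P₀)
    (hθ : IsGaussianParameter μ w θ θ₀ P₀)
    (hy : IsClosedLoopOutput μ f θ w (lsController f θ₀ P₀) y) (t : ℕ) :
    μ.map (fun ω => (frozenPath t (fun i => y i ω),
        normError f θ₀ P₀ (θ ω) t (fun i => y i ω))) =
      (μ.map fun ω => frozenPath t (fun i => y i ω)).prod (gaussianReal 0 1) := by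
  have hym := measurable_output hf hw hθ hy
  have hYm : ∀ t, Measurable fun ω => frozenPath t (fun i => y i ω) := fun t =>
    measurable_pi_lambda _ fun i => hym _
  induction t with
  | zero =>
    have hθm := hθ.measurable
    have hind : IndepFun (fun ω => frozenPath 0 (fun i => y i ω))
        (fun ω => normError f θ₀ P₀ (θ ω) 0 (fun i => y i ω)) μ := by
      have h := hy.indep_init.comp (φ := fun x : ℝ => fun _ : ℕ => x)
        (ψ := fun z : ℝ × (ℕ → ℝ) => (z.1 - θ₀) / √(P₀ : ℝ)) (by fun_prop) (by fun_prop)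
      have h0 : (fun ω => frozenPath 0 (fun i => y i ω)) =
          (fun x : ℝ => fun _ : ℕ => x) ∘ y 0 := by
        funext ω i
        simp [frozenPath]
      rw [h0]
      exact h
    rw [indepFun_iff_map_prod_eq_prod_map_map (hYm 0).aemeasurable
      (by simp only [normError, lsState]; fun_prop)] at hind
    rw [hind]
    congr 1
    have h1 : (fun ω => normError f θ₀ P₀ (θ ω) 0 (fun i => y i ω)) =
        (fun x => x / √(P₀ : ℝ)) ∘ (fun x => x - θ₀) ∘ θ := rfl
    rw [h1, ← Measure.map_map (by fun_prop) (by fun_prop), ← Measure.map_map (by fun_prop) hθm,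
      hθ.law, gaussianReal_map_sub_const, gaussianReal_map_div_const]
    have hne : P₀ ≠ 0 := hP.ne'
    congr 1
    · simp
    · ext
      simp [hne]
  | succ t ih =>
    have h1 := map_rotated hf hw hP hθ hy t ih
    set Y := fun ω => frozenPath t (fun i => y i ω) with hY
    have hprob := Measure.isProbabilityMeasure_map (μ := μ) (hYm t).aemeasurable
    have hEm : Measurable fun ω => normError f θ₀ P₀ (θ ω) (t + 1) (fun i => y i ω) :=
      measurable_normError hf hθ.measurable fun i _ => hym i
    have hVm : Measurable fun ω => innovation f θ₀ P₀ t (fun i => y i ω) :=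
      (hym _).div (measurable_predSigma hf fun i _ => hym i)
    -- Regroup as ((history, innovation), new error), so that the innovation can be absorbed into
    -- the history.
    have h2 := congrArg (Measure.map (Prod.map id Prod.swap)) h1
    rw [← Measure.map_prod_map _ _ measurable_id measurable_swap, Measure.map_id,
      Measure.prod_swap, ← Measure.prodAssoc_prod,
      Measure.map_map (by fun_prop) ((hYm t).prodMk (hEm.prodMk hVm))] at h2
    have h3 := congrArg (Measure.map MeasurableEquiv.prodAssoc.symm) h2
    rw [Measure.map_map (by fun_prop) (by fun_prop),
      Measure.map_map (by fun_prop) (by fun_prop)] at h3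
    -- `G` rebuilds the history at time t + 1 through y_{t+1} = σ_t v_t, the value repeated at every
    -- index beyond t.
    set G : (ℕ → ℝ) × ℝ → ℕ → ℝ := fun z i =>
      if i ≤ t then z.1 i else predSigma f θ₀ P₀ t z.1 * z.2 with hG
    have hGm : Measurable G := by
      refine measurable_pi_lambda _ fun i => ?_
      have := measurable_predSigma (θ₀ := θ₀) (P₀ := P₀) hf (t := t)
        (y := fun i (z : (ℕ → ℝ) × ℝ) => z.1 i) fun i _ => by fun_prop
      by_cases hi : i ≤ t
      · simp only [hG, hi, if_true]; fun_prop
      · simp only [hG, hi, if_false]; exact this.mul measurable_snd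
    have hGY : ∀ ω, G (Y ω, innovation f θ₀ P₀ t (fun i => y i ω)) =
        frozenPath (t + 1) (fun i => y i ω) := by
      intro ω
      have hfz : ∀ i ≤ t, Y ω i = y i ω := fun i hi => by simp [hY, frozenPath, hi]
      funext i
      by_cases hi : i ≤ t
      · simp [hG, hi, hfz, frozenPath, hi.trans (Nat.le_succ t)]
      · have hpos := one_le_predSigma (f := f) (θ₀ := θ₀) (P₀ := P₀) (by exact_mod_cast hP) t
          (fun i => y i ω)
        simp only [hG, hi, if_false, frozenPath, innovation]
        rw [predSigma_congr hfz, mul_div_cancel₀ _ (by linarith), min_eq_right (by omega)]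
    have h4 := congrArg (Measure.map (Prod.map G id)) h3
    simp only [MeasurableEquiv.symm_comp_self, Measure.map_id] at h4
    rw [← Measure.map_prod_map _ _ hGm measurable_id, Measure.map_id,
      Measure.map_map (by fun_prop)
        ((MeasurableEquiv.measurable _).comp
          ((measurable_id.prodMap measurable_swap).comp ((hYm t).prodMk (hEm.prodMk hVm))))] at h4
    have h5 : (Prod.map G id ∘ (MeasurableEquiv.prodAssoc.symm : (ℕ → ℝ) × ℝ × ℝ → _) ∘
        Prod.map id Prod.swap ∘ fun ω => (Y ω,
          (normError f θ₀ P₀ (θ ω) (t + 1) (fun i => y i ω),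
            innovation f θ₀ P₀ t (fun i => y i ω)))) =
        fun ω => (frozenPath (t + 1) (fun i => y i ω),
          normError f θ₀ P₀ (θ ω) (t + 1) (fun i => y i ω)) := by
      funext ω
      simp only [Function.comp_def, Prod.map, Prod.swap, id]
      exact Prod.ext (hGY ω) rfl
    rw [h5] at h4
    rw [h4]
    congr 1
    have h6 := congrArg (Measure.map Prod.fst) h4
    rw [Measure.map_fst_prod, measure_univ, one_smul,
      Measure.map_map measurable_fst ((hYm _).prodMk hEm)] at h6
    exact h6.symm

/-- The innovation is standard normal and independent of the outputs observed so far. -/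
theorem map_history_innovation (hf : Measurable f) (hw : IsStandardGaussianNoise μ w) (hP : 0 < P₀)
    (hθ : IsGaussianParameter μ w θ θ₀ P₀)
    (hy : IsClosedLoopOutput μ f θ w (lsController f θ₀ P₀) y) (t : ℕ) :
    μ.map (fun ω => (frozenPath t (fun i => y i ω), innovation f θ₀ P₀ t (fun i => y i ω))) =
      (μ.map fun ω => frozenPath t (fun i => y i ω)).prod (gaussianReal 0 1) := by
  have hym := measurable_output hf hw hθ hy
  have hYm : Measurable fun ω => frozenPath t (fun i => y i ω) :=
    measurable_pi_lambda _ fun i => hym _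
  have hEm : Measurable fun ω => normError f θ₀ P₀ (θ ω) (t + 1) (fun i => y i ω) :=
    measurable_normError hf hθ.measurable fun i _ => hym i
  have hVm : Measurable fun ω => innovation f θ₀ P₀ t (fun i => y i ω) :=
    (hym _).div (measurable_predSigma hf fun i _ => hym i)
  have hprob := Measure.isProbabilityMeasure_map (μ := μ) hYm.aemeasurable
  have h1 := congrArg (Measure.map (Prod.map id Prod.snd))
    (map_rotated hf hw hP hθ hy t (map_history_normError hf hw hP hθ hy t))
  rw [← Measure.map_prod_map _ _ measurable_id measurable_snd, Measure.map_id,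
    Measure.map_snd_prod, measure_univ, one_smul,
    Measure.map_map (by fun_prop) (hYm.prodMk (hEm.prodMk hVm))] at h1
  exact h1

end Innovation

/-! ### Bounds for piecewise continuous functions -/

section PiecewiseContinuous

variable {f : ℝ → ℝ}

lemma IsPiecewiseContinuous.measurable (hf : IsPiecewiseContinuous f) : Measurable f := by
  obtain ⟨D, hD, hc, -⟩ := hf
  have hcount : D.Countable := by
    have : D = ⋃ n : ℕ, D ∩ Set.Icc (-(n : ℝ)) n := by
      rw [← Set.inter_iUnion]
      refine (Set.inter_eq_left.2 fun x _ => ?_).symm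
      obtain ⟨n, hn⟩ := exists_nat_ge |x|
      exact Set.mem_iUnion.2 ⟨n, abs_le.1 hn⟩
    rw [this]
    exact Set.countable_iUnion fun n => (hD n).countable
  have := hcount.to_subtype
  refine measurable_of_measurable_union_cover D Dᶜ hcount.measurableSet
    hcount.measurableSet.compl (by simp) (measurable_of_countable _) ?_
  have : ContinuousOn f Dᶜ := fun x hx => (hc x hx).continuousWithinAt
  exact this.domRestrict.measurable

lemma IsPiecewiseContinuous.exists_nhds_bound (hf : IsPiecewiseContinuous f) (x : ℝ) :
    ∃ B, ∀ᶠ z in 𝓝 x, |f z| ≤ B := by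
  have key : ∀ (l : Filter ℝ) (c : ℝ), Tendsto f l (𝓝 c) → ∀ᶠ z in l, |f z| ≤ |c| + 1 :=
    fun l c h => (h.abs.eventually (gt_mem_nhds (lt_add_one _))).mono fun _ h => h.le
  obtain ⟨D, -, hc, hl⟩ := hf
  by_cases hx : x ∈ D
  · obtain ⟨⟨c, h1⟩, c', h2⟩ := hl x hx
    refine ⟨max (max (|c| + 1) (|c'| + 1)) |f x|, ?_⟩
    rw [← nhdsNE_sup_pure, ← nhdsLT_sup_nhdsGT, eventually_sup, eventually_sup]
    refine ⟨⟨(key _ _ h1).mono fun z h => ?_, (key _ _ h2).mono fun z h => ?_⟩, ?_⟩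
    · exact h.trans ((le_max_left _ _).trans (le_max_left _ _))
    · exact h.trans ((le_max_right _ _).trans (le_max_left _ _))
    · exact eventually_pure.2 (le_max_right _ _)
  · exact ⟨_, key _ _ (hc x hx)⟩

lemma IsPiecewiseContinuous.exists_bound (hf : IsPiecewiseContinuous f) (s : Set ℝ)
    (hs : IsCompact s) : ∃ B, ∀ x ∈ s, |f x| ≤ B := by
  refine hs.induction_on (p := fun s => ∃ B, ∀ x ∈ s, |f x| ≤ B) ⟨0, by simp⟩ ?_ ?_ ?_
  · rintro s t hst ⟨B, hB⟩
    exact ⟨B, fun x hx => hB x (hst hx)⟩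
  · rintro s t ⟨B, hB⟩ ⟨B', hB'⟩
    refine ⟨max B B', ?_⟩
    rintro x (hx | hx)
    · exact (hB x hx).trans (le_max_left _ _)
    · exact (hB' x hx).trans (le_max_right _ _)
  · intro x _
    obtain ⟨B, hB⟩ := hf.exists_nhds_bound x
    exact ⟨_, mem_nhdsWithin_of_mem_nhds hB, B, fun z hz => hz⟩

lemma IsPiecewiseContinuous.exists_growth_bound (hf : IsPiecewiseContinuous f) {a : ℝ}
    (h : f =O[Bornology.cobounded ℝ] fun x : ℝ => |x| ^ a + 1) :
    ∃ C, 1 ≤ C ∧ ∀ x, |f x| ≤ C * (1 + |x| ^ a) := by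
  obtain ⟨c, hc⟩ := isBigO_iff.1 h
  obtain ⟨R, hR⟩ := (Metric.isBounded_iff_subset_closedBall 0).1
    (Bornology.isBounded_def.2 (by rwa [compl_compl] : {x | ‖f x‖ ≤ c * ‖|x| ^ a + 1‖}ᶜᶜ ∈ _))
  obtain ⟨B, hB⟩ := hf.exists_bound (Metric.closedBall 0 R) (isCompact_closedBall _ _)
  refine ⟨max 1 (max c B), le_max_left _ _, fun x => ?_⟩
  have hx : 0 ≤ |x| ^ a := by positivity
  by_cases h1 : ‖f x‖ ≤ c * ‖|x| ^ a + 1‖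
  · rw [Real.norm_eq_abs, Real.norm_eq_abs, abs_of_nonneg (a := |x| ^ a + 1) (by positivity),
      add_comm] at h1
    refine h1.trans ?_
    gcongr
    exact (le_max_left _ _).trans (le_max_right _ _)
  · have h2 := hB x (hR h1)
    have h3 : B ≤ max 1 (max c B) := (le_max_right _ _).trans (le_max_right _ _)
    have h4 : (1 : ℝ) ≤ max 1 (max c B) := le_max_left _ _
    nlinarith

/-- For |x| ≥ 1 the exponent may be raised to b'. For |x| ≤ 1 a negative b makes |x|^b useless, and
the global bound gives |f x| ≤ 2C instead. -/
lemma abs_le_of_mem_slowGrowthSet {a b b' C L x : ℝ} (ha : 0 ≤ a) (hL : 0 < L) (hbb : b ≤ b')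
    (hC : 0 ≤ C) (hf : ∀ x, |f x| ≤ C * (1 + |x| ^ a)) (hx : x ∈ slowGrowthSet f b L) :
    |f x| ≤ (2 * C + L) * (1 + |x| ^ b') := by
  have h0 : 0 ≤ |x| ^ b' := by positivity
  rcases le_total 1 |x| with h | h
  · have h1 : |x| ^ b ≤ |x| ^ b' := Real.rpow_le_rpow_of_exponent_le h hbb
    have h2 : |f x| < L * |x| ^ b := hx
    nlinarith
  · have h1 : |x| ^ a ≤ 1 := Real.rpow_le_one (abs_nonneg x) h ha
    have h2 := hf x
    nlinarith

lemma measurableSet_slowGrowthSet (hf : Measurable f) (b L : ℝ) :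
    MeasurableSet (slowGrowthSet f b L) :=
  measurableSet_lt (by fun_prop) (by fun_prop)

end PiecewiseContinuous

/-! ### Gaussian mass at scale σ -/

section Gaussian

lemma gaussianReal_map_mul {σ : ℝ} : (gaussianReal 0 1).map (fun z => σ * z) =
    gaussianReal 0 (NNReal.mk (σ ^ 2) (sq_nonneg σ)) := by
  rw [gaussianReal_map_const_mul]; simp

/-- The mass that `N(0, σ²)` gives to a set dominates a multiple of Lebesgue measure on each
bounded interval. -/
lemma le_gaussianReal_preimage {σ R : ℝ} (hσ : 0 < σ) {A : Set ℝ} (hA : MeasurableSet A) :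
    ENNReal.ofReal ((√(2 * Real.pi) * σ)⁻¹ * Real.exp (-R ^ 2 / (2 * σ ^ 2))) *
        volume (A ∩ Set.Icc (-R) R) ≤ gaussianReal 0 1 {z | σ * z ∈ A} := by
  have h1 : gaussianReal 0 1 {z | σ * z ∈ A} =
      gaussianReal 0 (NNReal.mk (σ ^ 2) (sq_nonneg σ)) A := by
    rw [← gaussianReal_map_mul, Measure.map_apply (by fun_prop) hA]; rfl
  have hv : NNReal.mk (σ ^ 2) (sq_nonneg σ) ≠ 0 := by
    intro h
    have := congrArg NNReal.toReal h
    simp at this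
    exact hσ.ne' this
  rw [h1, gaussianReal_apply _ hv, ← setLIntegral_const]
  refine (setLIntegral_mono' (hA.inter measurableSet_Icc) fun x hx => ?_).trans
    (lintegral_mono_set Set.inter_subset_left)
  refine ENNReal.ofReal_le_ofReal ?_
  have h2 : x ^ 2 ≤ R ^ 2 := sq_le_sq' hx.2.1 hx.2.2
  rw [gaussianPDFReal]
  simp only [NNReal.coe_mk, sub_zero]
  rw [Real.sqrt_mul (x := 2 * Real.pi) (by positivity), Real.sqrt_sq hσ.le]
  gcongr

lemma gaussianReal_preimage_eq_zero {σ : ℝ} (hσ : 0 < σ) {A : Set ℝ} (hA : volume A = 0) :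
    gaussianReal 0 1 {z | σ * z ∈ A} = 0 := by
  have hv : NNReal.mk (σ ^ 2) (sq_nonneg σ) ≠ 0 := by
    intro h
    have := congrArg NNReal.toReal h
    simp at this
    exact hσ.ne' this
  have h1 : (gaussianReal 0 1).map (fun z => σ * z) A = 0 := by
    rw [gaussianReal_map_mul]
    exact gaussianReal_absolutelyContinuous _ hv hA
  exact Measure.preimage_null_of_map_null (by fun_prop) h1

/-- A lower density of order `1 / log log` for `S` bounds the chance that a Gaussian variable of
large standard deviation `σ` lands in `S`. -/
lemma exists_le_gaussianReal_preimage {S : Set ℝ} (hS : MeasurableSet S)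
    (h : 0 < liminf (fun l : ℝ => volume (S ∩ Set.Icc (-l) l) / ENNReal.ofReal l *
      ENNReal.ofReal (Real.log (Real.log l))) atTop) :
    ∃ c > 0, ∀ᶠ σ : ℝ in atTop, ∀ D > 0, Real.log (Real.log σ) ≤ D →
      ENNReal.ofReal (c / D) ≤ gaussianReal 0 1 {z | σ * z ∈ S} := by
  obtain ⟨e, he0, he⟩ := exists_between h
  -- The liminf may be infinite, so a finite positive constant is extracted below it.
  obtain ⟨e', he'0, he'⟩ : ∃ e' : ℝ, 0 < e' ∧ ENNReal.ofReal e' ≤ e := by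
    rcases eq_or_ne e ⊤ with rfl | hne
    · exact ⟨1, one_pos, le_top⟩
    · exact ⟨e.toReal, ENNReal.toReal_pos he0.ne' hne, ENNReal.ofReal_toReal_le⟩
  -- On [-σ, σ] the density of N(0, σ²) is at least k / σ.
  set k : ℝ := (√(2 * Real.pi))⁻¹ * Real.exp (-1 / 2) with hk
  have hk0 : 0 < k := by positivity
  refine ⟨k * e', by positivity, ?_⟩
  filter_upwards [eventually_lt_of_lt_liminf he, eventually_gt_atTop 0] with σ h1 h2 D hD h3
  refine le_trans ?_ (le_gaussianReal_preimage h2 hS (R := σ))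
  have h4 : ENNReal.ofReal e' ≤ volume (S ∩ Set.Icc (-σ) σ) / ENNReal.ofReal σ *
      ENNReal.ofReal D := (he'.trans h1.le).trans (by gcongr)
  have h5 : (√(2 * Real.pi) * σ)⁻¹ * Real.exp (-σ ^ 2 / (2 * σ ^ 2)) = k * σ⁻¹ := by
    rw [hk, mul_inv, neg_div, neg_div]
    have : σ ^ 2 / (2 * σ ^ 2) = 1 / 2 := by field_simp
    rw [this]; ring
  have hD' : ENNReal.ofReal D ≠ 0 := by simpa using hD
  rw [h5, mul_div_assoc, ENNReal.ofReal_mul hk0.le, ENNReal.ofReal_mul hk0.le, mul_assoc,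
    ENNReal.ofReal_div_of_pos hD, ENNReal.ofReal_inv_of_pos h2]
  gcongr
  rw [ENNReal.div_le_iff hD' ENNReal.ofReal_ne_top]
  refine h4.trans_eq ?_
  rw [ENNReal.div_eq_inv_mul]

/-- If `f` is not almost everywhere zero, then `E exp (-f (σ z)²)` is bounded away from `1` for
`σ` in a suitable interval `[1, K]`. -/
lemma exists_lintegral_exp_neg_le {f : ℝ → ℝ} (hf : Measurable f) (hne : ¬ f =ᵐ[volume] 0) :
    ∃ K : ℝ, 2 ≤ K ∧ ∃ q : ℝ≥0∞, q < 1 ∧ ∀ σ, 1 ≤ σ → σ ≤ K →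
      ∫⁻ z, ENNReal.ofReal (Real.exp (-f (σ * z) ^ 2)) ∂(gaussianReal 0 1) ≤ q := by
  -- The radius n + 2 also serves as K; K ≥ 2 is what the case σ ≥ K needs later.
  obtain ⟨n, hn⟩ : ∃ n : ℕ, volume ({x | 1 / ((n : ℝ) + 1) ≤ |f x|} ∩
      Set.Icc (-((n : ℝ) + 2)) (n + 2)) ≠ 0 := by
    by_contra! hcon
    apply hne
    rw [← measure_iUnion_null_iff] at hcon
    refine measure_mono_null (fun x hx => ?_) hcon
    have hx0 : 0 < |f x| := abs_pos.2 hx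
    obtain ⟨m, hm⟩ := exists_nat_one_div_lt hx0
    obtain ⟨k, hk⟩ := exists_nat_ge |x|
    refine Set.mem_iUnion.2 ⟨max m k, ?_, ?_⟩
    · refine le_trans ?_ hm.le
      gcongr
      exact le_max_left _ _
    · rw [Set.mem_Icc, ← abs_le]
      have : (k : ℝ) ≤ (max m k : ℕ) := by exact_mod_cast le_max_right _ _
      linarith
  set A := {x | 1 / ((n : ℝ) + 1) ≤ |f x|} with hA
  have hAm : MeasurableSet A := measurableSet_le measurable_const (by fun_prop)
  set K : ℝ := n + 2 with hK
  have hK2 : 2 ≤ K := by simp [hK]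
  set δ : ℝ := 1 / ((n : ℝ) + 1) with hδ
  have hδ0 : 0 < δ := by positivity
  have hc0 : 0 < 1 - Real.exp (-δ ^ 2) := by
    rw [sub_pos, Real.exp_lt_one_iff]
    nlinarith
  -- A lower bound for the chance of |f(σ z)| ≥ δ, uniform over 1 ≤ σ ≤ K.
  set d : ℝ≥0∞ := ENNReal.ofReal ((√(2 * Real.pi) * K)⁻¹ * Real.exp (-K ^ 2 / 2)) *
    volume (A ∩ Set.Icc (-K) K) with hd
  have hd0 : d ≠ 0 := by
    refine mul_ne_zero ?_ hn
    have : 0 < (√(2 * Real.pi) * K)⁻¹ * Real.exp (-K ^ 2 / 2) := by positivity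
    simpa using this
  refine ⟨K, hK2, 1 - ENNReal.ofReal (1 - Real.exp (-δ ^ 2)) * d,
    ENNReal.sub_lt_self ENNReal.one_ne_top one_ne_zero
      (mul_ne_zero (ENNReal.ofReal_pos.2 hc0).ne' hd0), ?_⟩
  intro σ h1 h2
  have hσ0 : 0 < σ := by linarith
  have hdle : d ≤ gaussianReal 0 1 {z | σ * z ∈ A} := by
    refine le_trans ?_ (le_gaussianReal_preimage hσ0 hAm (R := K))
    rw [hd]
    gcongr ENNReal.ofReal ?_ * _
    have h3 : -K ^ 2 / 2 ≤ -K ^ 2 / (2 * σ ^ 2) := by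
      rw [neg_div, neg_div, neg_le_neg_iff]
      gcongr
      nlinarith
    gcongr
  have hmeas : MeasurableSet {z | σ * z ∈ A} := hAm.preimage (by fun_prop)
  have hdtop : d ≠ ⊤ := (hdle.trans_lt (measure_lt_top _ _)).ne
  refine ENNReal.le_sub_of_add_le_right (ENNReal.mul_ne_top ENNReal.ofReal_ne_top hdtop) ?_
  calc _ ≤ ∫⁻ z, ENNReal.ofReal (Real.exp (-f (σ * z) ^ 2)) ∂(gaussianReal 0 1) +
        ENNReal.ofReal (1 - Real.exp (-δ ^ 2)) * gaussianReal 0 1 {z | σ * z ∈ A} := by gcongr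
    _ = ∫⁻ z, ENNReal.ofReal (Real.exp (-f (σ * z) ^ 2)) +
        {z | σ * z ∈ A}.indicator (fun _ => ENNReal.ofReal (1 - Real.exp (-δ ^ 2))) z
          ∂(gaussianReal 0 1) := by
        rw [lintegral_add_right _ (measurable_const.indicator hmeas),
          lintegral_indicator_const hmeas]
    _ ≤ ∫⁻ _, 1 ∂(gaussianReal 0 1) := by
        refine lintegral_mono fun z => ?_
        by_cases hz : z ∈ {z | σ * z ∈ A}
        · rw [Set.indicator_of_mem hz, ← ENNReal.ofReal_add (by positivity) hc0.le,
            ← ENNReal.ofReal_one]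
          refine ENNReal.ofReal_le_ofReal ?_
          have h4 : δ ^ 2 ≤ f (σ * z) ^ 2 := by
            rw [← sq_abs (f _)]
            exact pow_le_pow_left₀ hδ0.le hz 2
          have h5 : Real.exp (-f (σ * z) ^ 2) ≤ Real.exp (-δ ^ 2) := Real.exp_le_exp.2 (by linarith)
          linarith
        · rw [Set.indicator_of_notMem hz, add_zero, ← ENNReal.ofReal_one]
          refine ENNReal.ofReal_le_ofReal (Real.exp_le_one_iff.2 ?_)
          nlinarith [sq_nonneg (f (σ * z))]
    _ = 1 := by simp

end Gaussian

/-! ### Information along a path -/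

section Paths

variable {f : ℝ → ℝ} {θ₀ P₀ : ℝ}

/-- The information `1 / P_t` accumulated along the path `p`. -/
noncomputable def information (f : ℝ → ℝ) (θ₀ P₀ : ℝ) (t : ℕ) (p : ℕ → ℝ) : ℝ :=
  ((lsState f θ₀ P₀ p t).2)⁻¹

lemma information_pos (hP : 0 < P₀) (t : ℕ) (p : ℕ → ℝ) : 0 < information f θ₀ P₀ t p :=
  inv_pos.2 (lsState_snd_pos hP p t)

lemma information_succ (hP : 0 < P₀) (t : ℕ) (p : ℕ → ℝ) :
    information f θ₀ P₀ (t + 1) p = information f θ₀ P₀ t p + f (p t) ^ 2 :=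
  inv_lsState_snd_succ hP p t

lemma information_monotone (hP : 0 < P₀) (p : ℕ → ℝ) :
    Monotone fun t => information f θ₀ P₀ t p :=
  monotone_nat_of_le_succ fun t => by
    rw [information_succ hP]; nlinarith [sq_nonneg (f (p t))]

lemma predSigma_eq (hP : 0 < P₀) (t : ℕ) (p : ℕ → ℝ) : predSigma f θ₀ P₀ t p =
    √(information f θ₀ P₀ (t + 1) p / information f θ₀ P₀ t p) :=
  predSigma_eq_sqrt_div hP t p

lemma information_mul_predSigma_sq (hP : 0 < P₀) (t : ℕ) (p : ℕ → ℝ) :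
    information f θ₀ P₀ t p * predSigma f θ₀ P₀ t p ^ 2 =
      information f θ₀ P₀ t p + f (p t) ^ 2 := by
  have h0 := information_pos (f := f) (θ₀ := θ₀) hP t p
  have h1 := information_pos (f := f) (θ₀ := θ₀) hP (t + 1) p
  rw [predSigma_eq hP, Real.sq_sqrt (by positivity), ← information_succ hP]
  field_simp

lemma information_congr {t : ℕ} {p p' : ℕ → ℝ} (h : ∀ i ≤ t, p i = p' i) :
    information f θ₀ P₀ t p = information f θ₀ P₀ t p' := by
  rw [information, information, lsState_congr h]

lemma measurable_information {Ω : Type*} {m : MeasurableSpace Ω} (hf : Measurable f) {t : ℕ}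
    {y : ℕ → Ω → ℝ} (hy : ∀ i ≤ t, Measurable (y i)) :
    Measurable fun ω => information f θ₀ P₀ t (fun i => y i ω) :=
  (measurable_lsState hf hy).snd.inv

lemma predSigma_mul_innovation (hP : 0 < P₀) (t : ℕ) (p : ℕ → ℝ) :
    predSigma f θ₀ P₀ t p * innovation f θ₀ P₀ t p = p (t + 1) :=
  mul_div_cancel₀ _ (by linarith [one_le_predSigma (f := f) (θ₀ := θ₀) hP t p])

lemma frozenPath_apply {t i : ℕ} (h : i ≤ t) (p : ℕ → ℝ) : frozenPath t p i = p i := by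
  simp [frozenPath, h]

lemma measurable_predSigma_path (hf : Measurable f) (t : ℕ) :
    Measurable (predSigma f θ₀ P₀ t) :=
  measurable_predSigma hf (y := fun i (p : ℕ → ℝ) => p i) fun i _ => measurable_pi_apply i

lemma measurable_information_path (hf : Measurable f) (t : ℕ) :
    Measurable (information f θ₀ P₀ t) :=
  measurable_information hf (y := fun i (p : ℕ → ℝ) => p i) fun i _ => measurable_pi_apply i

end Paths

/-! ### Innovation averages and linear growth of information -/

section ClosedLoop

variable {Ω : Type*} [MeasurableSpace Ω] {μ : Measure Ω}
  {f : ℝ → ℝ} {w : ℕ → Ω → ℝ} {θ : Ω → ℝ} {θ₀ : ℝ} {P₀ : ℝ≥0} {y : ℕ → Ω → ℝ}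

lemma measurable_frozen_output (hf : Measurable f) (hw : IsStandardGaussianNoise μ w)
    (hθ : IsGaussianParameter μ w θ θ₀ P₀)
    (hy : IsClosedLoopOutput μ f θ w (lsController f θ₀ P₀) y) (t : ℕ) :
    Measurable fun ω => frozenPath t (fun i => y i ω) :=
  measurable_pi_lambda _ fun _ => measurable_output hf hw hθ hy _

lemma measurable_innovation (hf : Measurable f) (hw : IsStandardGaussianNoise μ w)
    (hθ : IsGaussianParameter μ w θ θ₀ P₀)
    (hy : IsClosedLoopOutput μ f θ w (lsController f θ₀ P₀) y) (t : ℕ) :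
    Measurable fun ω => innovation f θ₀ P₀ t (fun i => y i ω) :=
  (measurable_output hf hw hθ hy _).div
    (measurable_predSigma hf fun i _ => measurable_output hf hw hθ hy i)

variable [IsProbabilityMeasure μ]

lemma measure_history_innovation (hf : Measurable f) (hw : IsStandardGaussianNoise μ w)
    (hP : 0 < P₀) (hθ : IsGaussianParameter μ w θ θ₀ P₀)
    (hy : IsClosedLoopOutput μ f θ w (lsController f θ₀ P₀) y) (t : ℕ)
    {E : Set ((ℕ → ℝ) × ℝ)} (hE : MeasurableSet E) :
    μ {ω | (frozenPath t (fun i => y i ω), innovation f θ₀ P₀ t (fun i => y i ω)) ∈ E} =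
      ∫⁻ ω, gaussianReal 0 1 (Prod.mk (frozenPath t (fun i => y i ω)) ⁻¹' E) ∂μ := by
  have hYm := measurable_frozen_output hf hw hθ hy t
  have hVm := measurable_innovation hf hw hθ hy t
  have h := Measure.map_apply (μ := μ) (hYm.prodMk hVm) hE
  rw [map_history_innovation hf hw hP hθ hy t, Measure.prod_apply hE,
    lintegral_map (measurable_measure_prodMk_left hE) hYm] at h
  exact h.symm

lemma lintegral_history_innovation (hf : Measurable f) (hw : IsStandardGaussianNoise μ w)
    (hP : 0 < P₀) (hθ : IsGaussianParameter μ w θ θ₀ P₀)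
    (hy : IsClosedLoopOutput μ f θ w (lsController f θ₀ P₀) y) (t : ℕ)
    {H : (ℕ → ℝ) × ℝ → ℝ≥0∞} (hH : Measurable H) :
    ∫⁻ ω, H (frozenPath t (fun i => y i ω), innovation f θ₀ P₀ t (fun i => y i ω)) ∂μ =
      ∫⁻ ω, ∫⁻ z, H (frozenPath t (fun i => y i ω), z) ∂(gaussianReal 0 1) ∂μ := by
  have hYm := measurable_frozen_output hf hw hθ hy t
  have hVm := measurable_innovation hf hw hθ hy t
  rw [← lintegral_map (f := H) hH (hYm.prodMk hVm), map_history_innovation hf hw hP hθ hy t,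
    lintegral_prod _ hH.aemeasurable, lintegral_map hH.lintegral_prod_right' hYm]

lemma map_innovation (hf : Measurable f) (hw : IsStandardGaussianNoise μ w)
    (hP : 0 < P₀) (hθ : IsGaussianParameter μ w θ θ₀ P₀)
    (hy : IsClosedLoopOutput μ f θ w (lsController f θ₀ P₀) y) (t : ℕ) :
    μ.map (fun ω => innovation f θ₀ P₀ t (fun i => y i ω)) = gaussianReal 0 1 := by
  have hYm := measurable_frozen_output hf hw hθ hy t
  have hVm := measurable_innovation hf hw hθ hy t
  have hprob := Measure.isProbabilityMeasure_map (μ := μ) hYm.aemeasurable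
  have h := congrArg (Measure.map Prod.snd) (map_history_innovation hf hw hP hθ hy t)
  rw [Measure.map_snd_prod, measure_univ, one_smul,
    Measure.map_map measurable_snd (hYm.prodMk hVm)] at h
  exact h

/-- The innovation with index s depends only on the outputs up to s + 1 ≤ t. Pairwise independence
is all the strong law requires. -/
lemma indepFun_innovation_of_lt (hf : Measurable f) (hw : IsStandardGaussianNoise μ w)
    (hP : 0 < P₀) (hθ : IsGaussianParameter μ w θ θ₀ P₀)
    (hy : IsClosedLoopOutput μ f θ w (lsController f θ₀ P₀) y) {s t : ℕ} (hst : s < t) :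
    IndepFun (fun ω => innovation f θ₀ P₀ s (fun i => y i ω))
      (fun ω => innovation f θ₀ P₀ t (fun i => y i ω)) μ := by
  have hYm := measurable_frozen_output hf hw hθ hy t
  have hVm := measurable_innovation hf hw hθ hy t
  have h : IndepFun (fun ω => frozenPath t (fun i => y i ω))
      (fun ω => innovation f θ₀ P₀ t (fun i => y i ω)) μ := by
    rw [indepFun_iff_map_prod_eq_prod_map_map hYm.aemeasurable hVm.aemeasurable,
      map_innovation hf hw hP hθ hy, map_history_innovation hf hw hP hθ hy]
  have h2 := h.comp (φ := innovation f θ₀ P₀ s) (ψ := id)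
    ((measurable_pi_apply _).div (measurable_predSigma_path hf s)) measurable_id
  have h3 : innovation f θ₀ P₀ s ∘ (fun ω => frozenPath t (fun i => y i ω)) =
      fun ω => innovation f θ₀ P₀ s (fun i => y i ω) := by
    funext ω
    simp only [Function.comp, innovation]
    rw [frozenPath_apply hst, predSigma_congr fun i hi => frozenPath_apply (by omega) _]
  rw [h3] at h2
  exact h2

lemma integrable_exp_abs_gaussianReal :
    Integrable (fun x => Real.exp |x|) (gaussianReal 0 1) := by
  have h1 := integrable_exp_mul_gaussianReal (μ := 0) (v := 1) 1
  have h2 := integrable_exp_mul_gaussianReal (μ := 0) (v := 1) (-1)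
  refine (h1.add h2).mono' (by fun_prop) (ae_of_all _ fun x => ?_)
  rw [Real.norm_eq_abs, abs_of_pos (Real.exp_pos _)]
  simp only [Pi.add_apply, one_mul, neg_one_mul]
  rcases abs_choice x with h | h <;> rw [h] <;> linarith [Real.exp_pos x, Real.exp_pos (-x)]

/-- The averages of `exp |v_t|` along the innovation sequence `v` are bounded. -/
lemma ae_exists_sum_exp_innovation_le (hf : Measurable f) (hw : IsStandardGaussianNoise μ w)
    (hP : 0 < P₀) (hθ : IsGaussianParameter μ w θ θ₀ P₀)
    (hy : IsClosedLoopOutput μ f θ w (lsController f θ₀ P₀) y) :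
    ∀ᵐ ω ∂μ, ∃ K : ℝ, ∀ n : ℕ,
      ∑ i ∈ Finset.range n, Real.exp |innovation f θ₀ P₀ i (fun j => y j ω)| ≤ K * n := by
  have hexp : Measurable fun x : ℝ => Real.exp |x| := by fun_prop
  have hVm := measurable_innovation hf hw hθ hy
  have hlaw := map_innovation hf hw hP hθ hy
  have hslln := strong_law_ae_real (μ := μ)
    (fun t ω => Real.exp |innovation f θ₀ P₀ t (fun i => y i ω)|) ?_ ?_ ?_
  · filter_upwards [hslln] with ω hω
    obtain ⟨K, hK⟩ := hω.bddAbove_range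
    refine ⟨K, fun n => ?_⟩
    rcases Nat.eq_zero_or_pos n with rfl | hn
    · simp
    · exact (div_le_iff₀ (by exact_mod_cast hn)).1 (hK ⟨n, rfl⟩)
  · have h := integrable_exp_abs_gaussianReal
    rw [← hlaw 0, integrable_map_measure (by fun_prop) (hVm 0).aemeasurable] at h
    exact h
  · intro s t hst
    rcases lt_or_gt_of_ne hst with h | h
    · exact (indepFun_innovation_of_lt hf hw hP hθ hy h).comp hexp hexp
    · exact ((indepFun_innovation_of_lt hf hw hP hθ hy h).comp hexp hexp).symm
  · intro i
    exact (IdentDistrib.mk (hVm i).aemeasurable (hVm 0).aemeasurable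
      ((hlaw i).trans (hlaw 0).symm)).comp hexp

/-- If `f` vanishes almost everywhere, then it vanishes along the outputs. -/
lemma ae_output_eq_zero (hf : Measurable f) (hw : IsStandardGaussianNoise μ w)
    (hP : 0 < P₀) (hθ : IsGaussianParameter μ w θ θ₀ P₀)
    (hy : IsClosedLoopOutput μ f θ w (lsController f θ₀ P₀) y) (h0 : f =ᵐ[volume] 0) :
    ∀ᵐ ω ∂μ, ∀ t, f (y (t + 1) ω) = 0 := by
  rw [ae_all_iff]
  intro t
  have hP' : (0 : ℝ) < P₀ := by exact_mod_cast hP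
  have hσ := measurable_predSigma_path (θ₀ := θ₀) (P₀ := P₀) hf t
  have hm : Measurable fun z : (ℕ → ℝ) × ℝ => predSigma f θ₀ P₀ t z.1 * z.2 :=
    (hσ.comp measurable_fst).mul measurable_snd
  have hS : MeasurableSet {x | f x ≠ 0} := (measurableSet_eq_fun hf measurable_const).compl
  have h1 := measure_history_innovation hf hw hP hθ hy t (hm hS)
  have h2 : ∀ ω, gaussianReal 0 1 (Prod.mk (frozenPath t (fun i => y i ω)) ⁻¹'
      ((fun z : (ℕ → ℝ) × ℝ => predSigma f θ₀ P₀ t z.1 * z.2) ⁻¹' {x | f x ≠ 0})) = 0 := fun ω =>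
    gaussianReal_preimage_eq_zero (A := {x | f x ≠ 0})
      (lt_of_lt_of_le one_pos (one_le_predSigma (f := f) (θ₀ := θ₀) hP' t
        (frozenPath t (fun i => y i ω)))) h0
  simp only [h2, lintegral_zero] at h1
  refine measure_mono_null (fun ω hω => ?_) h1
  simp only [Set.mem_preimage, Set.mem_ofPred_eq]
  rw [predSigma_congr fun i hi => frozenPath_apply hi _, predSigma_mul_innovation hP']
  exact hω

/-- Two steps always add information. If σ_t ≤ K, then f(y_{t+1})² is bounded below with positive
conditional probability. If σ_t ≥ K ≥ 2, then already f(y_t)² = r_t (σ_t² - 1) ≥ 3 r_t ≥ 3 / P₀. -/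
lemma exists_lintegral_exp_neg_information_le (hf : Measurable f)
    (hw : IsStandardGaussianNoise μ w) (hP : 0 < P₀) (hθ : IsGaussianParameter μ w θ θ₀ P₀)
    (hy : IsClosedLoopOutput μ f θ w (lsController f θ₀ P₀) y) (hne : ¬ f =ᵐ[volume] 0) :
    ∃ q : ℝ≥0∞, q < 1 ∧ ∀ t,
      ∫⁻ ω, ENNReal.ofReal (Real.exp (-information f θ₀ P₀ (t + 2) (fun i => y i ω))) ∂μ ≤
      q * ∫⁻ ω, ENNReal.ofReal (Real.exp (-information f θ₀ P₀ t (fun i => y i ω))) ∂μ := by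
  have hP' : (0 : ℝ) < P₀ := by exact_mod_cast hP
  obtain ⟨K, hK, q, hq, hKq⟩ := exists_lintegral_exp_neg_le hf hne
  refine ⟨max q (ENNReal.ofReal (Real.exp (-(3 * (P₀ : ℝ)⁻¹)))), max_lt hq ?_, fun t => ?_⟩
  · rw [ENNReal.ofReal_lt_one, Real.exp_lt_one_iff]
    have : (0 : ℝ) < (P₀ : ℝ)⁻¹ := inv_pos.2 hP'
    linarith
  have hσ : Measurable fun z : (ℕ → ℝ) × ℝ => predSigma f θ₀ P₀ t z.1 :=
    (measurable_predSigma_path hf t).comp measurable_fst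
  have hI : Measurable fun z : (ℕ → ℝ) × ℝ => information f θ₀ P₀ t z.1 :=
    (measurable_information_path hf t).comp measurable_fst
  have h1 := lintegral_history_innovation hf hw hP hθ hy t
    (H := fun z => ENNReal.ofReal (Real.exp (-(information f θ₀ P₀ t z.1 + f (z.1 t) ^ 2))) *
      ENNReal.ofReal (Real.exp (-f (predSigma f θ₀ P₀ t z.1 * z.2) ^ 2))) (by fun_prop)
  have h2 : ∀ ω, ENNReal.ofReal (Real.exp (-information f θ₀ P₀ (t + 2) (fun i => y i ω))) =
      ENNReal.ofReal (Real.exp (-(information f θ₀ P₀ t (frozenPath t (fun i => y i ω)) +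
        f (frozenPath t (fun i => y i ω) t) ^ 2))) *
      ENNReal.ofReal (Real.exp (-f (predSigma f θ₀ P₀ t (frozenPath t (fun i => y i ω)) *
        innovation f θ₀ P₀ t (fun i => y i ω)) ^ 2)) := by
    intro ω
    rw [← ENNReal.ofReal_mul (by positivity), ← Real.exp_add,
      predSigma_congr fun i hi => frozenPath_apply hi _, predSigma_mul_innovation hP',
      frozenPath_apply le_rfl, information_congr fun i hi => frozenPath_apply hi _,
      information_succ hP' (t + 1), information_succ hP' t, neg_add _ (f (y (t + 1) ω) ^ 2)]
  have hexpm : Measurable fun ω =>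
      ENNReal.ofReal (Real.exp (-information f θ₀ P₀ t (fun i => y i ω))) :=
    (measurable_information hf fun i _ => measurable_output hf hw hθ hy i).neg.exp.ennreal_ofReal
  simp_rw [h2]
  rw [h1, ← lintegral_const_mul _ hexpm]
  refine lintegral_mono fun ω => ?_
  simp only
  set p := frozenPath t (fun i => y i ω) with hp
  rw [lintegral_const_mul _ (by fun_prop), ← information_congr (p := p)
    fun i hi => frozenPath_apply hi _]
  set Q := ENNReal.ofReal (Real.exp (-(3 * (P₀ : ℝ)⁻¹))) with hQ
  have hσ1 := one_le_predSigma (f := f) (θ₀ := θ₀) hP' t p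
  rcases le_total (predSigma f θ₀ P₀ t p) K with h | h
  · rw [mul_comm]
    refine mul_le_mul' ((hKq _ hσ1 h).trans (le_max_left _ _)) ?_
    refine ENNReal.ofReal_le_ofReal (Real.exp_le_exp.2 ?_)
    nlinarith [sq_nonneg (f (p t))]
  · have h3 : ∫⁻ z, ENNReal.ofReal (Real.exp (-f (predSigma f θ₀ P₀ t p * z) ^ 2))
        ∂(gaussianReal 0 1) ≤ 1 := by
      calc _ ≤ ∫⁻ _, 1 ∂(gaussianReal 0 1) := by
            refine lintegral_mono fun z => ?_
            rw [← ENNReal.ofReal_one]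
            refine ENNReal.ofReal_le_ofReal (Real.exp_le_one_iff.2 ?_)
            nlinarith [sq_nonneg (f (predSigma f θ₀ P₀ t p * z))]
        _ = 1 := by simp
    calc _ ≤ ENNReal.ofReal (Real.exp (-(information f θ₀ P₀ t p + f (p t) ^ 2))) * 1 := by gcongr
      _ ≤ Q * ENNReal.ofReal (Real.exp (-information f θ₀ P₀ t p)) := by
          rw [mul_one, hQ, ← ENNReal.ofReal_mul (by positivity), ← Real.exp_add]
          refine ENNReal.ofReal_le_ofReal (Real.exp_le_exp.2 ?_)
          have h4 := information_mul_predSigma_sq (f := f) (θ₀ := θ₀) hP' t p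
          have h5 : (P₀ : ℝ)⁻¹ ≤ information f θ₀ P₀ t p :=
            information_monotone (f := f) (θ₀ := θ₀) hP' p (Nat.zero_le t)
          have h6 : 4 ≤ predSigma f θ₀ P₀ t p ^ 2 := by nlinarith
          have h7 := information_pos (f := f) (θ₀ := θ₀) hP' t p
          nlinarith
      _ ≤ _ := by gcongr; exact le_max_right _ _

/-- If `f` is not almost everywhere zero, the information grows at least linearly. -/
lemma ae_exists_linear_le_information (hf : Measurable f)
    (hw : IsStandardGaussianNoise μ w) (hP : 0 < P₀) (hθ : IsGaussianParameter μ w θ θ₀ P₀)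
    (hy : IsClosedLoopOutput μ f θ w (lsController f θ₀ P₀) y) (hne : ¬ f =ᵐ[volume] 0) :
    ∃ c > 0, ∀ᵐ ω ∂μ, ∀ᶠ t : ℕ in atTop, c * t ≤ information f θ₀ P₀ t (fun i => y i ω) := by
  have hP' : (0 : ℝ) < P₀ := by exact_mod_cast hP
  obtain ⟨q, hq, hqt⟩ := exists_lintegral_exp_neg_information_le hf hw hP hθ hy hne
  have hpow : ∀ n : ℕ, ∫⁻ ω, ENNReal.ofReal
      (Real.exp (-information f θ₀ P₀ (2 * n) (fun i => y i ω))) ∂μ ≤ q ^ n := by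
    intro n
    induction n with
    | zero =>
      calc _ ≤ ∫⁻ _, 1 ∂μ := by
            refine lintegral_mono fun ω => ?_
            rw [← ENNReal.ofReal_one]
            refine ENNReal.ofReal_le_ofReal (Real.exp_le_one_iff.2 ?_)
            linarith [information_pos (f := f) (θ₀ := θ₀) hP' (2 * 0) (fun i => y i ω)]
        _ = q ^ 0 := by simp
    | succ n ih =>
      rw [pow_succ']
      exact (hqt (2 * n)).trans (by gcongr)
  -- For q < s < 1, Markov's inequality at level s^n gives the summable bound (q/s)^n, and
  -- Borel–Cantelli applies.
  obtain ⟨s, hqs, hs1⟩ := ENNReal.lt_iff_exists_real_btwn.1 hq |>.imp fun s h => h.2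
  have hs0 : 0 < s := ENNReal.ofReal_pos.1 (bot_le.trans_lt hqs)
  rw [ENNReal.ofReal_lt_one] at hs1
  set l := -Real.log s with hl
  have hl0 : 0 < l := neg_pos.2 (Real.log_neg hs0 hs1)
  have hsum : ∑' n : ℕ, μ {ω | ENNReal.ofReal s ^ n ≤ ENNReal.ofReal
      (Real.exp (-information f θ₀ P₀ (2 * n) (fun i => y i ω)))} ≠ ⊤ := by
    have hs' : ENNReal.ofReal s ≠ 0 := (ENNReal.ofReal_pos.2 hs0).ne'
    have h1 : ∀ n : ℕ, μ {ω | ENNReal.ofReal s ^ n ≤ ENNReal.ofReal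
      (Real.exp (-information f θ₀ P₀ (2 * n) (fun i => y i ω)))} ≤ (q / ENNReal.ofReal s) ^ n := by
      intro n
      have hm := measurable_information (θ₀ := θ₀) (P₀ := P₀) hf (t := 2 * n)
        fun i _ => measurable_output hf hw hθ hy i
      refine (meas_ge_le_lintegral_div hm.neg.exp.ennreal_ofReal.aemeasurable (pow_ne_zero _ hs')
        (ENNReal.pow_ne_top ENNReal.ofReal_ne_top)).trans ?_
      rw [ENNReal.div_eq_inv_mul, ENNReal.div_eq_inv_mul, mul_pow, ENNReal.inv_pow]
      gcongr
      exact hpow n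
    refine ((ENNReal.tsum_le_tsum h1).trans_lt ?_).ne
    rw [ENNReal.tsum_geometric, ENNReal.inv_lt_top, tsub_pos_iff_lt]
    exact ENNReal.div_lt_of_lt_mul (by rwa [one_mul])
  -- Eventually r_{2n} > n l; the 4 comes from t ≤ 4 ⌊t/2⌋ for t ≥ 2.
  refine ⟨l / 4, by positivity, ?_⟩
  filter_upwards [ae_eventually_notMem hsum] with ω hω
  obtain ⟨N, hN⟩ := eventually_atTop.1 hω
  filter_upwards [eventually_ge_atTop (2 * N + 2)] with t ht
  have h1 := hN (t / 2) (by omega)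
  simp only [not_le] at h1
  rw [← ENNReal.ofReal_pow hs0.le, ENNReal.ofReal_lt_ofReal_iff (by positivity),
    ← Real.lt_log_iff_exp_lt (by positivity), Real.log_pow] at h1
  have h2 := information_monotone (f := f) (θ₀ := θ₀) hP' (fun i => y i ω)
    (show 2 * (t / 2) ≤ t by omega)
  simp only at h2
  have h3 : (t : ℝ) ≤ 4 * (t / 2 : ℕ) := by
    have : t ≤ 4 * (t / 2) := by omega
    exact_mod_cast this
  nlinarith

end ClosedLoop

/-! ### Recurrence of the slow growth set -/

section Recurrence

variable {Ω : Type*} [MeasurableSpace Ω] {μ : Measure Ω} [IsProbabilityMeasure μ]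
  {f : ℝ → ℝ} {w : ℕ → Ω → ℝ} {θ : Ω → ℝ} {θ₀ : ℝ} {P₀ : ℝ≥0} {y : ℕ → Ω → ℝ}

/-- The paths that avoid `S` during the steps `N, …, N + n - 1`, although at each step `t` the
conditional probability of a visit is at least `c / (t + 1)`. -/
def avoidingPaths (f : ℝ → ℝ) (θ₀ P₀ : ℝ) (S : Set ℝ) (c : ℝ) (N n : ℕ) : Set (ℕ → ℝ) :=
  {p | ∀ t, N ≤ t → t < N + n →
    ENNReal.ofReal (c / (t + 1 : ℕ)) ≤ gaussianReal 0 1 {z | predSigma f θ₀ P₀ t p * z ∈ S} ∧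
      p (t + 1) ∉ S}

lemma measurable_gaussianReal_preimage {S : Set ℝ} (hS : MeasurableSet S) :
    Measurable fun σ : ℝ => gaussianReal 0 1 {z | σ * z ∈ S} :=
  measurable_measure_prodMk_left (ν := gaussianReal 0 1)
    (s := (fun x : ℝ × ℝ => x.1 * x.2) ⁻¹' S) (hS.preimage (by fun_prop))

lemma measurableSet_avoidingPaths (hf : Measurable f) {S : Set ℝ} (hS : MeasurableSet S)
    {θ₀ P₀ c : ℝ} {N n : ℕ} : MeasurableSet (avoidingPaths f θ₀ P₀ S c N n) := by
  have : avoidingPaths f θ₀ P₀ S c N n = ⋂ t, ⋂ (_ : N ≤ t), ⋂ (_ : t < N + n),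
      ({p | ENNReal.ofReal (c / (t + 1 : ℕ)) ≤
        gaussianReal 0 1 {z | predSigma f θ₀ P₀ t p * z ∈ S}} ∩ {p | p (t + 1) ∈ S}ᶜ) := by
    ext p
    simp [avoidingPaths]
  rw [this]
  refine MeasurableSet.iInter fun t => MeasurableSet.iInter fun _ => MeasurableSet.iInter fun _ =>
    MeasurableSet.inter ?_ (hS.preimage (measurable_pi_apply _)).compl
  exact measurableSet_le measurable_const
    ((measurable_gaussianReal_preimage hS).comp (measurable_predSigma_path hf t))

lemma mem_avoidingPaths_congr {S : Set ℝ} {θ₀ P₀ c : ℝ} {N n : ℕ} {p p' : ℕ → ℝ}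
    (h : ∀ i ≤ N + n, p i = p' i) (hp : p ∈ avoidingPaths f θ₀ P₀ S c N n) :
    p' ∈ avoidingPaths f θ₀ P₀ S c N n := by
  intro t h1 h2
  rw [← predSigma_congr (p := p) fun i hi => h i (by omega), ← h (t + 1) (by omega)]
  exact hp t h1 h2

/-- Whether a path avoids `S` up to time N + n, and whether the next visit is likely, is decided by
the history; the independent innovation then misses `S` with conditional probability at most 1 -
c/(N+n+1) ≤ exp(-c/(N+n+1)). -/
lemma measure_avoidingPaths_succ_le (hf : Measurable f) (hw : IsStandardGaussianNoise μ w)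
    (hP : 0 < P₀) (hθ : IsGaussianParameter μ w θ θ₀ P₀)
    (hy : IsClosedLoopOutput μ f θ w (lsController f θ₀ P₀) y) {S : Set ℝ} (hS : MeasurableSet S)
    {c : ℝ} (hc : 0 < c) (N n : ℕ) :
    μ {ω | (fun i => y i ω) ∈ avoidingPaths f θ₀ P₀ S c N (n + 1)} ≤
      ENNReal.ofReal (Real.exp (-(c / (N + n + 1 : ℕ)))) *
        μ {ω | (fun i => y i ω) ∈ avoidingPaths f θ₀ P₀ S c N n} := by
  have hP' : (0 : ℝ) < P₀ := by exact_mod_cast hP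
  set B := avoidingPaths f θ₀ P₀ S c N n with hB
  set T := N + n with hT
  have hBm : MeasurableSet B := measurableSet_avoidingPaths hf hS
  set A : Set (ℕ → ℝ) := {p | ENNReal.ofReal (c / (T + 1 : ℕ)) ≤
    gaussianReal 0 1 {z | predSigma f θ₀ P₀ T p * z ∈ S}} with hA
  have hσ := measurable_predSigma_path (θ₀ := θ₀) (P₀ := P₀) hf T
  have hAm : MeasurableSet A := measurableSet_le measurable_const
    ((measurable_gaussianReal_preimage hS).comp hσ)
  set E : Set ((ℕ → ℝ) × ℝ) := Prod.fst ⁻¹' (B ∩ A) ∩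
    ((fun z : (ℕ → ℝ) × ℝ => predSigma f θ₀ P₀ T z.1 * z.2) ⁻¹' S)ᶜ with hE
  have hEm : MeasurableSet E := (measurable_fst (hBm.inter hAm)).inter
    (((hσ.comp measurable_fst).mul measurable_snd) hS).compl
  have hYm := measurable_frozen_output hf hw hθ hy T
  calc μ {ω | (fun i => y i ω) ∈ avoidingPaths f θ₀ P₀ S c N (n + 1)}
      ≤ μ {ω | (frozenPath T (fun i => y i ω), innovation f θ₀ P₀ T (fun i => y i ω)) ∈ E} := by
        refine measure_mono fun ω hω => ?_
        have h1 : (fun i => y i ω) ∈ avoidingPaths f θ₀ P₀ S c N (n + 1) := hω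
        obtain ⟨h2, h3⟩ := h1 T (by omega) (by omega)
        have h4 : predSigma f θ₀ P₀ T (frozenPath T (fun i => y i ω)) =
            predSigma f θ₀ P₀ T (fun i => y i ω) :=
          predSigma_congr fun i hi => frozenPath_apply hi _
        refine ⟨⟨mem_avoidingPaths_congr (p := fun i => y i ω)
          (fun i hi => (frozenPath_apply hi (fun i => y i ω)).symm) fun t ht ht' =>
            h1 t ht (by omega), ?_⟩, ?_⟩
        · change _ ≤ gaussianReal 0 1 {z | predSigma f θ₀ P₀ T _ * z ∈ S}
          rwa [h4]
        · change ¬ (predSigma f θ₀ P₀ T _ * _ ∈ S)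
          rwa [h4, predSigma_mul_innovation hP']
    _ = ∫⁻ ω, gaussianReal 0 1 (Prod.mk (frozenPath T (fun i => y i ω)) ⁻¹' E) ∂μ :=
        measure_history_innovation hf hw hP hθ hy T hEm
    _ ≤ ∫⁻ ω, ((fun ω => frozenPath T (fun i => y i ω)) ⁻¹' B).indicator
          (fun _ => ENNReal.ofReal (Real.exp (-(c / (T + 1 : ℕ))))) ω ∂μ := by
        refine lintegral_mono fun ω => ?_
        by_cases h : frozenPath T (fun i => y i ω) ∈ B ∩ A
        · rw [Set.indicator_of_mem
            (show ω ∈ (fun ω => frozenPath T (fun i => y i ω)) ⁻¹' B from h.1)]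
          set s := predSigma f θ₀ P₀ T (frozenPath T (fun i => y i ω)) with hs
          have h5 : Prod.mk (frozenPath T (fun i => y i ω)) ⁻¹' E ⊆ {z | s * z ∈ S}ᶜ :=
            fun z hz => hz.2
          refine (measure_mono h5).trans ?_
          rw [prob_compl_eq_one_sub (show MeasurableSet {z | s * z ∈ S} from
            hS.preimage (measurable_const_mul s))]
          refine (tsub_le_tsub_left h.2 1).trans ?_
          rw [← ENNReal.ofReal_one, ← ENNReal.ofReal_sub _ (by positivity)]
          refine ENNReal.ofReal_le_ofReal ?_
          linarith [Real.add_one_le_exp (-(c / (T + 1 : ℕ)))]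
        · have h5 : Prod.mk (frozenPath T (fun i => y i ω)) ⁻¹' E = ∅ :=
            Set.eq_empty_of_forall_notMem fun z hz => h hz.1
          rw [h5, measure_empty]
          exact bot_le
    _ = ENNReal.ofReal (Real.exp (-(c / (T + 1 : ℕ)))) *
          μ ((fun ω => frozenPath T (fun i => y i ω)) ⁻¹' B) :=
        lintegral_indicator_const (hYm hBm) _
    _ ≤ _ := by
        refine mul_le_mul_right
          (measure_mono fun ω (hω : frozenPath T (fun i => y i ω) ∈ B) => ?_) _
        exact mem_avoidingPaths_congr (fun i hi => frozenPath_apply hi (fun i => y i ω)) hω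

/-- If the conditional probability of a visit to `S` at time `t + 1` is eventually at least
`c / (t + 1)`, then `S` is visited infinitely often. -/
lemma ae_frequently_mem (hf : Measurable f) (hw : IsStandardGaussianNoise μ w)
    (hP : 0 < P₀) (hθ : IsGaussianParameter μ w θ θ₀ P₀)
    (hy : IsClosedLoopOutput μ f θ w (lsController f θ₀ P₀) y) {S : Set ℝ}
    (hS : MeasurableSet S) :
    ∀ᵐ ω ∂μ, ∀ c > 0, (∀ᶠ t : ℕ in atTop, ENNReal.ofReal (c / (t + 1 : ℕ)) ≤
        gaussianReal 0 1 {z | predSigma f θ₀ P₀ t (fun i => y i ω) * z ∈ S}) →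
      ∃ᶠ t in atTop, y (t + 1) ω ∈ S := by
  have hnull : ∀ (c : ℝ) (N : ℕ), 0 < c →
      μ {ω | ∀ n, (fun i => y i ω) ∈ avoidingPaths f θ₀ P₀ S c N n} = 0 := by
    intro c N hc
    have hle : ∀ n : ℕ, μ {ω | (fun i => y i ω) ∈ avoidingPaths f θ₀ P₀ S c N n} ≤
        ENNReal.ofReal (Real.exp (-(c * ∑ i ∈ Finset.range n, 1 / (((N + i : ℕ) : ℝ) + 1)))) := by
      intro n
      induction n with
      | zero => simpa using prob_le_one
      | succ n ih =>
        refine (measure_avoidingPaths_succ_le hf hw hP hθ hy hS hc N n).trans ?_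
        refine (mul_le_mul_right ih _).trans_eq ?_
        rw [← ENNReal.ofReal_mul (by positivity), ← Real.exp_add, Finset.sum_range_succ]
        push_cast
        ring_nf
    have hlim : Tendsto (fun n : ℕ => ENNReal.ofReal (Real.exp
        (-(c * ∑ i ∈ Finset.range n, 1 / (((N + i : ℕ) : ℝ) + 1))))) atTop (𝓝 0) := by
      have h1 : Tendsto (fun n : ℕ => ∑ i ∈ Finset.range n, 1 / (((N + i : ℕ) : ℝ) + 1))
          atTop atTop := by
        have h2 := Real.tendsto_sum_range_one_div_nat_succ_atTop.comp (tendsto_add_atTop_nat N)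
        have h3 := tendsto_atTop_add_const_right atTop
          (-∑ i ∈ Finset.range N, 1 / ((i : ℝ) + 1)) h2
        refine h3.congr fun n => ?_
        simp only [Function.comp]
        rw [add_comm n N, Finset.sum_range_add]
        ring
      have h4 := ENNReal.tendsto_ofReal (Real.tendsto_exp_neg_atTop_nhds_zero.comp
        (h1.const_mul_atTop hc))
      rwa [ENNReal.ofReal_zero] at h4
    refine le_antisymm (ge_of_tendsto' hlim fun n => ?_) bot_le
    exact (measure_mono (Set.ofPred_subset_ofPred.2 fun ω hω => hω n)).trans (hle n)
  -- Restricting c to the values 1/(m+1) keeps the exceptional null sets countable in number.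
  have hall : ∀ᵐ ω ∂μ, ∀ (m N : ℕ),
      ¬ ∀ n, (fun i => y i ω) ∈ avoidingPaths f θ₀ P₀ S (1 / ((m : ℝ) + 1)) N n := by
    rw [ae_all_iff]; intro m
    rw [ae_all_iff]; intro N
    rw [ae_iff]
    simp only [not_not]
    exact hnull _ N (by positivity)
  filter_upwards [hall] with ω hω c hc hev hcon
  obtain ⟨m, hm⟩ := exists_nat_one_div_lt hc
  obtain ⟨N, hN⟩ := eventually_atTop.1 (hev.and hcon)
  refine hω m N fun n t ht _ => ⟨le_trans ?_ (hN t ht).1, (hN t ht).2⟩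
  gcongr

end Recurrence

/-! ### Stability of the closed loop -/

section Main

variable {Ω : Type*} [MeasurableSpace Ω] {μ : Measure Ω} [IsProbabilityMeasure μ]
  {f : ℝ → ℝ} {w : ℕ → Ω → ℝ} {θ : Ω → ℝ} {θ₀ : ℝ} {P₀ : ℝ≥0} {y : ℕ → Ω → ℝ}

lemma isFeedbackLaw_lsController (hf : Measurable f) {P₀ : ℝ} :
    IsFeedbackLaw (lsController f θ₀ P₀) := by
  intro t
  have h : ∀ i ≤ t, Measurable[Filtration.piLE (X := fun _ : ℕ => ℝ) t] fun p : ℕ → ℝ => p i := by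
    intro i hi
    exact (measurable_pi_apply (X := fun _ : Set.Iic t => ℝ) ⟨i, hi⟩).comp (comap_measurable _)
  have h1 := measurable_lsState (θ₀ := θ₀) (P₀ := P₀) hf h
  exact h1.fst.neg.mul (hf.comp (h t le_rfl))

/-- Bounded variance ratios give bounded averages of the squared outputs. -/
lemma bddAbove_average {y V σ : ℕ → ℝ} {M K : ℝ} (hy : ∀ t, y (t + 1) = σ t * V t)
    (hσ : ∀ t, σ t ^ 2 ≤ M)
    (hK : ∀ n : ℕ, ∑ i ∈ Finset.range n, Real.exp |V i| ≤ K * n) :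
    BddAbove ((fun t : ℕ => (1 / (t : ℝ)) * ∑ i ∈ Finset.Icc 1 t, (y i) ^ 2) '' Set.Ici 1) := by
  have hM : 0 ≤ M := (sq_nonneg (σ 0)).trans (hσ 0)
  refine ⟨2 * M * K, ?_⟩
  rintro _ ⟨t, ht, rfl⟩
  have ht0 : (0 : ℝ) < t := by exact_mod_cast (Nat.lt_of_succ_le ht)
  have h1 : ∑ i ∈ Finset.Icc 1 t, (y i) ^ 2 = ∑ i ∈ Finset.range t, (y (i + 1)) ^ 2 := by
    rw [Finset.range_eq_Ico, Finset.sum_Ico_add' (fun i => y i ^ 2) 0 t 1]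
    rfl
  have h2 : ∑ i ∈ Finset.range t, (y (i + 1)) ^ 2 ≤
      ∑ i ∈ Finset.range t, 2 * M * Real.exp |V i| := by
    refine Finset.sum_le_sum fun i _ => ?_
    have h3 := Real.quadratic_le_exp_of_nonneg (abs_nonneg (V i))
    have h4 : V i ^ 2 ≤ 2 * Real.exp |V i| := by
      rw [← sq_abs]; nlinarith [abs_nonneg (V i)]
    calc y (i + 1) ^ 2 = σ i ^ 2 * V i ^ 2 := by rw [hy]; ring
      _ ≤ M * (2 * Real.exp |V i|) := by gcongr; exact hσ i
      _ = 2 * M * Real.exp |V i| := by ring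
  rw [← Finset.mul_sum] at h2
  simp only
  rw [h1, one_div, inv_mul_le_iff₀ ht0]
  have h5 := mul_le_mul_of_nonneg_left (hK t) (show 0 ≤ 2 * M by positivity)
  linarith

/-- Almost surely the variance ratios along the closed loop are bounded. -/
lemma ae_exists_information_ratio_le (hf : IsPiecewiseContinuous f)
    (hw : IsStandardGaussianNoise μ w) (hP : 0 < P₀) (hθ : IsGaussianParameter μ w θ θ₀ P₀)
    (hy : IsClosedLoopOutput μ f θ w (lsController f θ₀ P₀) y) {a : ℝ} (ha : 4 ≤ a)
    (hgrowth : f =O[Bornology.cobounded ℝ] fun x : ℝ => |x| ^ a + 1) {xmin : ℝ}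
    (hxmin : IsLeast {x : ℝ | x ^ 2 - (a - 2) * x + 1 = 0} xmin)
    {b L : ℝ} (hb : b < (1 + xmin) ^ 2) (hL : 0 < L)
    (hdensity : 0 < liminf (fun l : ℝ =>
      volume (slowGrowthSet f b L ∩ Set.Icc (-l) l) / ENNReal.ofReal l *
        ENNReal.ofReal (Real.log (Real.log l))) atTop)
    (hne : ¬ f =ᵐ[volume] 0) :
    ∀ᵐ ω ∂μ, ∃ M, ∀ t, information f θ₀ P₀ (t + 1) (fun i => y i ω) /
      information f θ₀ P₀ t (fun i => y i ω) ≤ M := by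
  have hfm := hf.measurable
  have hP' : (0 : ℝ) < P₀ := by exact_mod_cast hP
  have hx1 : xmin ^ 2 - (a - 2) * xmin + 1 = 0 := hxmin.1
  have hx0 : 0 < xmin := by
    by_contra! h
    nlinarith [sq_nonneg xmin]
  -- By Vieta, a - 2 - xmin is the other root.
  have hxle : xmin ≤ a - 2 - xmin := hxmin.2 (by
    change (a - 2 - xmin) ^ 2 - (a - 2) * (a - 2 - xmin) + 1 = 0
    linear_combination hx1)
  -- The equation gives (1 + xmin)² = a · xmin, and xmin ≤ 1 because the roots have product 1.
  have hpa : (1 + xmin) ^ 2 ≤ a := by nlinarith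
  obtain ⟨C, hC1, hC⟩ := hf.exists_growth_bound hgrowth
  have hSm := measurableSet_slowGrowthSet hfm b L
  obtain ⟨e, he0, he⟩ := exists_le_gaussianReal_preimage hSm hdensity
  obtain ⟨c, hc0, hc⟩ := ae_exists_linear_le_information hfm hw hP hθ hy hne
  filter_upwards [hc, ae_exists_sum_exp_innovation_le hfm hw hP hθ hy,
    ae_frequently_mem hfm hw hP hθ hy hSm] with ω hgrow hsum hhit
  obtain ⟨K, hK⟩ := hsum
  set p : ℕ → ℝ := fun i => y i ω with hp
  have hba : max b 0 ≤ a := max_le (by linarith) (by linarith)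
  have hbp : max b 0 < (1 + xmin) ^ 2 := max_lt hb (by positivity)
  -- The shift t - 1 pairs y_{t+1} with the innovation of index t; the value of v at 0 is never
  -- used. Replacing b by max b 0 makes the exponent nonnegative.
  refine variance_ratio_bounded (f := f) (S := slowGrowthSet f b L) (y := p)
    (v := fun t => innovation f θ₀ P₀ (t - 1) p) (C := 2 * C + L) (K := K) (a := a)
    (b := max b 0) (p := 1 + xmin) (q := 1 + (a - 2 - xmin)) (by linarith) (by linarith)
    (by linarith) (by ring) (by linarith) (le_max_right _ _) hba hbp
    (fun t => information_pos hP' t p) (fun t => information_succ hP' t p) ?_ ?_ ?_ ?_ hc0 hgrow ?_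
  · intro t
    rw [← predSigma_eq hP', Nat.add_sub_cancel, ← abs_of_pos (lt_of_lt_of_le one_pos
      (one_le_predSigma (f := f) (θ₀ := θ₀) hP' t p)), ← abs_mul,
      predSigma_mul_innovation hP']
  · intro x
    have h0 : 0 ≤ |x| ^ a := by positivity
    nlinarith [hC x]
  · intro x hx
    exact abs_le_of_mem_slowGrowthSet (by linarith) hL (le_max_left _ _) (by linarith) hC hx
  · intro t ht
    refine le_trans ?_ (hK t)
    exact Finset.single_le_sum (f := fun i => Real.exp |innovation f θ₀ P₀ i p|)
      (fun i _ => (Real.exp_pos _).le) (Finset.mem_range.2 (by omega : t - 1 < t))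
  · rintro hσ ⟨D, hD⟩
    simp_rw [← predSigma_eq hP'] at hσ hD
    -- D may be nonpositive, hence the maximum with 1.
    refine hhit (e / max D 1) (by positivity) ?_
    filter_upwards [hσ.eventually he, hD] with t h1 h2
    rw [div_div]
    refine h1 (max D 1 * (t + 1 : ℕ)) (by positivity) (h2.trans ?_)
    gcongr
    exact le_max_left _ _

end Main

theorem theorem2p2 {Ω : Type*} [MeasurableSpace Ω] (μ : Measure Ω) [IsProbabilityMeasure μ]
    (f : ℝ → ℝ) (hf : IsPiecewiseContinuous f)
    (w : ℕ → Ω → ℝ) (hw : IsStandardGaussianNoise μ w)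
    (θ : Ω → ℝ) (θ₀ : ℝ) (P₀ : ℝ≥0) (hP₀ : 0 < P₀) (hθ : IsGaussianParameter μ w θ θ₀ P₀)
    (a : ℝ) (ha : 4 ≤ a)
    (hgrowth : f =O[Bornology.cobounded ℝ] fun x : ℝ => |x| ^ a + 1)
    (xmin : ℝ) (hxmin : IsLeast {x : ℝ | x ^ 2 - (a - 2) * x + 1 = 0} xmin)
    (b L : ℝ) (hb : b < (1 + xmin) ^ 2) (hL : 0 < L)
    (hdensity : 0 < liminf (fun l : ℝ =>
      volume (slowGrowthSet f b L ∩ Set.Icc (-l) l) / ENNReal.ofReal l *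
        ENNReal.ofReal (Real.log (Real.log l))) atTop) :
    GloballyStabilizable μ f θ w ∧
      GloballyStabilizedBy μ f θ w (lsController f θ₀ P₀) := by
  have hfm := hf.measurable
  have hP' : (0 : ℝ) < P₀ := by exact_mod_cast hP₀
  suffices h : GloballyStabilizedBy μ f θ w (lsController f θ₀ P₀) from ⟨⟨_, h⟩, h⟩
  refine ⟨isFeedbackLaw_lsController hfm, fun y hy => ?_⟩
  have hratio : ∀ᵐ ω ∂μ, ∃ M, ∀ t, information f θ₀ P₀ (t + 1) (fun i => y i ω) /
      information f θ₀ P₀ t (fun i => y i ω) ≤ M := by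
    -- If f vanishes almost everywhere, the information need not grow. Only y_0 can then have f ≠ 0,
    -- so every ratio after the first is 1.
    by_cases hne : f =ᵐ[volume] 0
    · filter_upwards [ae_output_eq_zero hfm hw hP₀ hθ hy hne] with ω hω
      refine ⟨max 1 (information f θ₀ P₀ 1 (fun i => y i ω) /
        information f θ₀ P₀ 0 (fun i => y i ω)), fun t => ?_⟩
      cases t with
      | zero => exact le_max_right _ _
      | succ t =>
        rw [information_succ hP' (t + 1), hω t, zero_pow two_ne_zero, add_zero,
          div_self (information_pos hP' _ _).ne']
        exact le_max_left _ _
    · exact ae_exists_information_ratio_le hf hw hP₀ hθ hy ha hgrowth hxmin hb hL hdensity hne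
  filter_upwards [hratio, ae_exists_sum_exp_innovation_le hfm hw hP₀ hθ hy] with ω h1 h2
  obtain ⟨M, hM⟩ := h1
  obtain ⟨K, hK⟩ := h2
  refine bddAbove_average (M := M) (σ := fun t => predSigma f θ₀ P₀ t (fun i => y i ω))
    (fun t => (predSigma_mul_innovation hP' t (fun i => y i ω)).symm) (fun t => ?_) hK
  have h3 := information_pos (f := f) (θ₀ := θ₀) hP' t (fun i => y i ω)
  have h4 := information_pos (f := f) (θ₀ := θ₀) hP' (t + 1) (fun i => y i ω)
  rw [predSigma_eq hP', Real.sq_sqrt (by positivity)]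
  exact hM t
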